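/- Let $G$ be a locally compact (Hausdorff) group with a fixed left Haar measure $\mu$, let $p\in(1,\infty)$ with $p\neq 2$, and let $L^p(G)=L^p(G,\mu)$ be the complex $L^p$-space. For $s\in G$ let $\lambda_p(s)$ and $\rho_p(s)$ be the bounded operators on $L^p(G)$ given by $(\lambda_p(s)\xi)(t)=\xi(s^{-1}t)$ and $(\rho_p(s)\xi)(t)=\xi(ts)$. Let $$CV_p(G)=\{a\in B(L^p(G)) : a\rho_p(s)=\rho_p(s)a \text{ for all } s\in G\}$$ be the algebra of $p$-convolvers with the operator norm, and let $\mathcal U=\mathcal U(CV_p(G))$ be the group of its invertible isometries, that is, of the invertible $u\in CV_p(G)$ with $\|u\|=\|u^{-1}\|=1$. Identify $B(L^p(G))$ with the dual of the projective tensor product $L^p(G)\,\widehat{\otimes}\,L^p(G)^*$ through $\langle a,\xi\otimes\eta\rangle=\eta(a\xi)$, and write $\mathcal U_{w^*}$ for $\mathcal U$ with the restriction of the resulting weak*-topology. Let $\mathcal U_0$ be the connected component of the unit of $\mathcal U$ in the norm topology (a normal subgroup), put $\pi_0(\mathcal U)=\mathcal U/\mathcal U_0$, and write $\pi_0(\mathcal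 U)_{w^*}$ for this group with the quotient topology induced by $\mathcal U_{w^*}\to\pi_0(\mathcal U)$. Let $\mathbb T$ be the group of complex numbers of modulus one. Then the maps $$\Delta\colon \mathbb T\times G\to \mathcal U_{w^*},\quad \Delta(\gamma,s)=\gamma\lambda_p(s),\qquad\text{and}\qquad \Delta'\colon G\to\pi_0(\mathcal U)_{w^*},\quad \Delta'(s)=[\lambda_p(s)],$$ are well defined and are isomorphisms of topological groups (group isomorphisms that are homeomorphisms). -/

import Mathlib

open MeasureTheory Topology
open scoped ENNReal NNReal

noncomputable section

namespace Convolvers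

/-! ### Weak-star (ultraweak) topology on the bounded operators of a reflexive space -/

section WeakStar

variable (E : Type*) [NormedAddCommGroup E] [NormedSpace ℂ E]

/-- Representatives of the elements of the projective tensor product of `E` with its dual:
an element is a series `∑ n, ξ n ⊗ η n` with `∑ n, ‖ξ n‖ * ‖η n‖ < ∞`. -/
structure NuclearSeries where
  vec : ℕ → E
  fnl : ℕ → StrongDual ℂ E
  summable_norm : Summable fun n => ‖vec n‖ * ‖fnl n‖

variable {E}

/-- The duality pairing `⟨a, ω⟩ = ∑ n, ⟨a (ξ n), η n⟩` between bounded operators and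
`ω = ∑ n, ξ n ⊗ η n` (the series converges absolutely). -/
def NuclearSeries.pairing (ω : NuclearSeries E) (a : E →L[ℂ] E) : ℂ :=
  ∑' n, ω.fnl n (a (ω.vec n))

variable (E)

/-- The weak-star topology on the bounded operators of a reflexive Banach space `E`, viewed as
the dual of the projective tensor product of `E` and its dual: the coarsest topology that makes
all pairings `a ↦ ⟨a, ω⟩` continuous. -/
@[reducible] def weakStarTopology : TopologicalSpace (E →L[ℂ] E) :=
  ⨅ ω : NuclearSeries E, TopologicalSpace.induced ω.pairing inferInstance

end WeakStar

/-! ### Invertible isometries of a unital Banach algebra -/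

section InvertibleIsometries

variable (A : Type*) [NormedRing A] [NormOneClass A]

/-- The group of invertible isometries of a unital Banach algebra: the invertible `u` with
`‖u‖ = ‖u⁻¹‖ = 1`. -/
def invertibleIsometries : Subgroup Aˣ where
  carrier := {u | ‖(u : A)‖ = 1 ∧ ‖((u⁻¹ : Aˣ) : A)‖ = 1}
  one_mem' := by simp
  inv_mem' := by
    rintro u ⟨h1, h2⟩
    exact ⟨h2, by simpa using h1⟩
  mul_mem' := by
    rintro u v ⟨hu, hu'⟩ ⟨hv, hv'⟩
    have h1 : ‖((u * v : Aˣ) : A)‖ ≤ 1 := by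
      rw [Units.val_mul]; exact (norm_mul_le _ _).trans (by rw [hu, hv, one_mul])
    have h2 : ‖(((u * v)⁻¹ : Aˣ) : A)‖ ≤ 1 := by
      rw [mul_inv_rev, Units.val_mul]; exact (norm_mul_le _ _).trans (by rw [hu', hv', one_mul])
    have h3 : 1 ≤ ‖((u * v : Aˣ) : A)‖ * ‖(((u * v)⁻¹ : Aˣ) : A)‖ := by
      rw [← norm_one (α := A), ← Units.mul_inv (u * v)]; exact norm_mul_le _ _
    have h4 := norm_nonneg ((u * v : Aˣ) : A)
    have h5 := norm_nonneg (((u * v)⁻¹ : Aˣ) : A)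
    exact ⟨by nlinarith, by nlinarith⟩

/-- The connected component of the unit in the group of invertible isometries, for the norm
topology. (The topology used is the one inherited from the group of units; by
`isInducing_coe_invertibleIsometries` it is the topology of the norm.) -/
def unitComponent : Subgroup (invertibleIsometries A) :=
  Subgroup.connectedComponentOfOne (invertibleIsometries A)

instance : (unitComponent A).Normal where
  conj_mem := by
    intro u hu g
    have hc : Continuous fun x : invertibleIsometries A => g * x * g⁻¹ := by fun_prop
    have h := hc.image_connectedComponent_subset 1 ⟨u, hu, rfl⟩
    simpa [unitComponent, Subgroup.connectedComponentOfOne] using h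

theorem isInducing_coe_invertibleIsometries :
    IsInducing (fun u : invertibleIsometries A => ((u : Aˣ) : A)) := by
  have key : ∀ u v : invertibleIsometries A,
      dist (((u : Aˣ)⁻¹ : Aˣ) : A) (((v : Aˣ)⁻¹ : Aˣ) : A) ≤ dist ((u : Aˣ) : A) ((v : Aˣ) : A) := by
    intro u v
    have h : (((u : Aˣ)⁻¹ : Aˣ) : A) - (((v : Aˣ)⁻¹ : Aˣ) : A)
        = (((u : Aˣ)⁻¹ : Aˣ) : A) * (((v : Aˣ) : A) - ((u : Aˣ) : A)) * (((v : Aˣ)⁻¹ : Aˣ) : A) := by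
      rw [mul_sub, sub_mul]; simp [mul_assoc]
    rw [dist_eq_norm, h, dist_comm, dist_eq_norm]
    calc _ ≤ ‖(((u : Aˣ)⁻¹ : Aˣ) : A)‖ * ‖((v : Aˣ) : A) - ((u : Aˣ) : A)‖
            * ‖(((v : Aˣ)⁻¹ : Aˣ) : A)‖ :=
          (norm_mul_le _ _).trans (by gcongr; exact norm_mul_le _ _)
      _ = _ := by rw [u.2.2, v.2.2, one_mul, mul_one]
  have h1 : IsInducing (fun u : invertibleIsometries A =>
      (((u : Aˣ) : A), MulOpposite.op (((u : Aˣ)⁻¹ : Aˣ) : A))) :=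
    Units.isInducing_embedProduct.comp IsInducing.subtypeVal
  rw [isInducing_iff_nhds]
  intro u
  apply le_antisymm
  · exact Filter.map_le_iff_le_comap.1
      ((Units.continuous_val.comp continuous_subtype_val).tendsto u)
  · rw [h1.nhds_eq_comap, ← Filter.tendsto_iff_comap, nhds_prod_eq, Filter.tendsto_prod_iff']
    refine ⟨Filter.tendsto_comap, ?_⟩
    refine (MulOpposite.continuous_op.tendsto _).comp ?_
    rw [tendsto_iff_dist_tendsto_zero]
    have h2 := tendsto_iff_dist_tendsto_zero.1
      (Filter.tendsto_comap (f := fun u : invertibleIsometries A => ((u : Aˣ) : A))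
        (x := 𝓝 ((u : Aˣ) : A)))
    exact squeeze_zero (fun _ => dist_nonneg) (fun v => key v u) h2

end InvertibleIsometries

/-! ### Regular representations and convolvers -/

/-- A left Haar measure on a locally compact group: a nonzero left-invariant Radon measure. Both
usual meanings of "Radon" are allowed (outer regular on Borel sets and inner regular on open
sets, or inner regular on Borel sets); they lead to the same `L^p`-spaces. -/
class IsLeftHaar {G : Type*} [Group G] [TopologicalSpace G] [MeasurableSpace G]
    (μ : Measure G) : Prop extends μ.IsHaarMeasure where
  radon : μ.Regular ∨ μ.InnerRegular

section Regular

variable {G : Type*} [Group G] [TopologicalSpace G] [IsTopologicalGroup G]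
  [LocallyCompactSpace G] [MeasurableSpace G] [BorelSpace G]
  (p : ℝ≥0∞) [Fact (1 ≤ p)] (μ : Measure G) [IsLeftHaar μ]

/-- The left regular representation `λ_p(s) ξ (t) = ξ (s⁻¹ t)` on `L^p(G)`. -/
def leftRegular (s : G) : Lp ℂ p μ →L[ℂ] Lp ℂ p μ :=
  (Lp.compMeasurePreservingₗᵢ ℂ (fun t : G => s⁻¹ * t)
    (measurePreserving_mul_left μ s⁻¹)).toContinuousLinearMap

theorem map_mul_right_eq (s : G) : ∃ c : ℝ≥0, c ≠ 0 ∧ μ.map (· * s) = c • μ := by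
  refine ⟨Measure.haarScalarFactor (μ.map (· * s)) μ,
    (Measure.haarScalarFactor_pos_of_isHaarMeasure _ _).ne', ?_⟩
  rcases IsLeftHaar.radon (μ := μ) with h | h
  · have : (μ.map (· * s)).Regular := Measure.Regular.map (Homeomorph.mulRight s)
    exact Measure.isMulLeftInvariant_eq_smul_of_regular _ μ
  · exact Measure.isMulLeftInvariant_eq_smul_of_innerRegular _ μ

theorem quasiMeasurePreserving_mul_right' (s : G) :
    Measure.QuasiMeasurePreserving (· * s) μ μ := by
  obtain ⟨c, -, hc⟩ := map_mul_right_eq μ s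
  refine ⟨measurable_mul_const s, ?_⟩
  rw [hc]
  exact Measure.smul_absolutelyContinuous

theorem exists_eLpNorm_comp_mul_right (s : G) : ∃ C : ℝ≥0, ∀ ξ : Lp ℂ p μ,
    eLpNorm (fun t => ξ (t * s)) p μ ≤ C * eLpNorm ξ p μ := by
  obtain ⟨c, hc0, hc⟩ := map_mul_right_eq μ s
  have hC : (c : ℝ≥0∞) ^ (1 / p).toReal ≠ ∞ := by
    exact ENNReal.rpow_ne_top_of_nonneg ENNReal.toReal_nonneg ENNReal.coe_ne_top
  refine ⟨((c : ℝ≥0∞) ^ (1 / p).toReal).toNNReal, fun ξ => ?_⟩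
  have hm : MeasurePreserving (· * s) μ (c • μ) := ⟨measurable_mul_const s, hc⟩
  have h1 : AEStronglyMeasurable ξ (c • μ) :=
    (Lp.aestronglyMeasurable ξ).mono_ac Measure.smul_absolutelyContinuous
  have h2 := eLpNorm_comp_measurePreserving (p := p) h1 hm
  change eLpNorm (ξ ∘ (· * s)) p μ ≤ _
  rw [h2, ENNReal.coe_toNNReal hC]
  exact eLpNorm_smul_measure_le (c : ℝ≥0∞) ξ p μ

theorem memLp_comp_mul_right (s : G) (ξ : Lp ℂ p μ) : MemLp (fun t => ξ (t * s)) p μ := by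
  obtain ⟨C, hC⟩ := exists_eLpNorm_comp_mul_right p μ s
  exact ⟨(Lp.aestronglyMeasurable ξ).comp_quasiMeasurePreserving
    (quasiMeasurePreserving_mul_right' μ s),
    (hC ξ).trans_lt (ENNReal.mul_lt_top ENNReal.coe_lt_top (Lp.memLp ξ).2)⟩

/-- The right regular representation `ρ_p(s) ξ (t) = ξ (t s)` on `L^p(G)`. -/
def rightRegular (s : G) : Lp ℂ p μ →L[ℂ] Lp ℂ p μ :=
  LinearMap.mkContinuousOfExistsBound
    { toFun := fun ξ => (memLp_comp_mul_right p μ s ξ).toLp (fun t => ξ (t * s))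
      map_add' := by
        intro ξ η
        rw [← MemLp.toLp_add, MemLp.toLp_eq_toLp_iff]
        exact (quasiMeasurePreserving_mul_right' μ s).ae_eq_comp (Lp.coeFn_add ξ η)
      map_smul' := by
        intro a ξ
        rw [RingHom.id_apply, ← MemLp.toLp_const_smul, MemLp.toLp_eq_toLp_iff]
        exact (quasiMeasurePreserving_mul_right' μ s).ae_eq_comp (Lp.coeFn_smul a ξ) }
    (by
      obtain ⟨C, hC⟩ := exists_eLpNorm_comp_mul_right p μ s
      refine ⟨C, fun ξ => ?_⟩
      change ‖(memLp_comp_mul_right p μ s ξ).toLp _‖ ≤ _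
      rw [Lp.norm_toLp, Lp.norm_def]
      calc _ ≤ ((C : ℝ≥0∞) * eLpNorm ξ p μ).toReal :=
            ENNReal.toReal_mono
              (ENNReal.mul_ne_top ENNReal.coe_ne_top (Lp.memLp ξ).2.ne) (hC ξ)
        _ = _ := by simp)

/-- The algebra `CV_p(G)` of `p`-convolvers: the bounded operators on `L^p(G)` that commute with
all right translations. It carries the operator norm. -/
abbrev CV : Subalgebra ℂ (Lp ℂ p μ →L[ℂ] Lp ℂ p μ) :=
  Subalgebra.centralizer ℂ (Set.range (rightRegular p μ))

instance instNontrivialLp : Nontrivial (Lp ℂ p μ) := by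
  obtain ⟨K, hK, hK1⟩ := exists_compact_mem_nhds (1 : G)
  have hU : IsOpen (interior K) := isOpen_interior
  have hpos : 0 < μ (interior K) := hU.measure_pos μ ⟨1, mem_interior_iff_mem_nhds.2 hK1⟩
  have hfin : μ (interior K) ≠ ∞ :=
    ((measure_mono interior_subset).trans_lt hK.measure_lt_top).ne
  refine ⟨⟨indicatorConstLp p hU.measurableSet hfin (1 : ℂ), 0, fun h => ?_⟩⟩
  have h0 : p ≠ 0 := (zero_lt_one.trans_le (Fact.out : 1 ≤ p)).ne'
  have hn := norm_indicatorConstLp' (p := p) (hs := hU.measurableSet) (hμs := hfin)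
    (c := (1 : ℂ)) h0 hpos.ne'
  rw [h, norm_zero, norm_one, one_mul] at hn
  have : 0 < (μ (interior K)).toReal := ENNReal.toReal_pos hpos.ne' hfin
  exact absurd hn (Real.rpow_pos_of_pos this _).ne

instance instNormOneClassCV : NormOneClass (CV p μ) :=
  ⟨by
    change ‖ContinuousLinearMap.id ℂ (Lp ℂ p μ)‖ = 1
    exact ContinuousLinearMap.norm_id⟩

/-- The group `U(CV_p(G))` of invertible isometries of `CV_p(G)`. As a type synonym, it carries
the weak-star topology (see the instance below) instead of the norm topology. -/
def UnitaryCV : Type _ := invertibleIsometries (CV p μ)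

instance : Group (UnitaryCV p μ) := inferInstanceAs (Group (invertibleIsometries (CV p μ)))

variable {p μ} in
/-- The operator on `L^p(G)` underlying an element of `U(CV_p(G))`. -/
def UnitaryCV.toOperator (u : UnitaryCV p μ) : Lp ℂ p μ →L[ℂ] Lp ℂ p μ :=
  (((show invertibleIsometries (CV p μ) from u : (CV p μ)ˣ) : CV p μ) :
    Lp ℂ p μ →L[ℂ] Lp ℂ p μ)

/-- The restriction to `U(CV_p(G))` of the weak-star topology of `B(L^p(G))`. -/
instance : TopologicalSpace (UnitaryCV p μ) :=
  TopologicalSpace.induced UnitaryCV.toOperator (weakStarTopology (Lp ℂ p μ))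

/-- `U(CV_p(G))_0`, the connected component of the unit in the *norm* topology. -/
def UnitaryCV.unitComponent : Subgroup (UnitaryCV p μ) :=
  Convolvers.unitComponent (CV p μ)

instance : (UnitaryCV.unitComponent p μ).Normal :=
  inferInstanceAs (Convolvers.unitComponent (CV p μ)).Normal

/-- `π_0(U(CV_p(G)))`, the quotient of `U(CV_p(G))` by the norm-connected component of its unit.
Its topology is the quotient topology of the weak-star topology. -/
abbrev Pi0UnitaryCV : Type _ := UnitaryCV p μ ⧸ UnitaryCV.unitComponent p μ

end Regular

end Convolvers

end

open Convolvers

namespace Convolvers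

open scoped CompactlySupported Pointwise

set_option linter.unusedSectionVars false

/-! ### Lamperti's theorem: isometries of `L^p` preserve disjointness -/

section Lamperti

/-! For `p ≠ 2` the norm of `L^p` detects disjointness of supports: by convexity or concavity of `x
↦ x ^ (p / 2)`, the pointwise Clarkson defect has a constant strict sign wherever both functions are
nonzero, so its integral vanishes only for disjoint functions (`ae_disjoint_iff_clarksonDefect`).
Hence isometries preserve disjointness (`ae_disjoint_of_isometry`).

Let `T` be an isometry commuting with right translations, and let `V` be a compact neighbourhood of
the unit. For `s ∉ V⁻¹ * V` the indicator of `V` is disjoint from its right translate by `s`, so the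
same is true of its image under `T`; this confines the essential support of that image to a
translate of `V⁻¹ * V`. By compactness these supports have a common point `x₀`
(`exists_forall_mem_essSupport_map`), and then `T 1_V` vanishes off `x₀ • V` for every compact `V`
(`ae_map_oneLp_eq_zero`).

A convolution `u * g` is an average of left translates of `g` and also an average of right
translates of `u`. The second description gives `T (1_V * g) = (T 1_V) * g`. By the first, for small
`V` the argument `1_V * g` is close to `μ(V) g`, while the right side is close to a multiple of
`λ(x₀) g`. Comparing and using compactness of the unit disc gives `T = c λ(x₀)`
(`exists_eq_smul_leftRegular`), so `Δ` is onto.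

Strong continuity of `λ_p` makes `Δ` weak-star continuous; pairing with indicators recovers first
`s` and then `γ` continuously. Multiples of distinct left translations are more than `1` apart in
norm, so the norm component of the unit is the circle of scalars, and `Δ'` is obtained from `Δ` by
dividing out `Circle`. -/

/-- The defect of the two-by-two identity `‖a + b‖ ^ r + ‖a - b‖ ^ r = 2 ‖a‖ ^ r + 2 ‖b‖ ^ r`. -/
noncomputable def clarksonDefect {E : Type*} [NormedAddCommGroup E] (r : ℝ) (a b : E) : ℝ :=
  ‖a + b‖ ^ r + ‖a - b‖ ^ r - 2 * ‖a‖ ^ r - 2 * ‖b‖ ^ r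

theorem clarksonDefect_of_eq_zero {E : Type*} [NormedAddCommGroup E] {r : ℝ} (hr : 0 < r) {a b : E}
    (h : a = 0 ∨ b = 0) : clarksonDefect r a b = 0 := by
  rcases h with rfl | rfl <;> simp [clarksonDefect, Real.zero_rpow hr.ne'] <;> ring

theorem norm_rpow_eq_sq_rpow {E : Type*} [NormedAddCommGroup E] (r : ℝ) (a : E) :
    ‖a‖ ^ r = (‖a‖ ^ 2) ^ (r / 2) := by
  rw [← Real.rpow_natCast, ← Real.rpow_mul (norm_nonneg _)]
  congr 1; push_cast; ring

theorem parallelogram_half (a b : ℂ) :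
    (1 / 2 : ℝ) • ‖a + b‖ ^ 2 + (1 / 2 : ℝ) • ‖a - b‖ ^ 2 = ‖a‖ ^ 2 + ‖b‖ ^ 2 := by
  have := parallelogram_law_with_norm ℂ a b
  simp only [smul_eq_mul]; nlinarith

/-- With `x = ‖a‖²`, `y = ‖b‖²`, the parallelogram law and convexity of the power `r / 2` bound the
first two terms of the defect below by `2 (x + y) ^ (r / 2)`; strict superadditivity of that power
finishes. -/
theorem clarksonDefect_pos {r : ℝ} (hr : 2 < r) {a b : ℂ} (ha : a ≠ 0) (hb : b ≠ 0) :
    0 < clarksonDefect r a b := by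
  have hq : 1 < r / 2 := by linarith
  have hx : 0 < ‖a‖ ^ 2 := by positivity
  have hy : 0 < ‖b‖ ^ 2 := by positivity
  have h1 := (convexOn_rpow hq.le).2 (sq_nonneg ‖a + b‖) (sq_nonneg ‖a - b‖)
    (by norm_num : (0 : ℝ) ≤ 1 / 2) (by norm_num : (0 : ℝ) ≤ 1 / 2) (by norm_num)
  rw [parallelogram_half] at h1
  simp only [smul_eq_mul] at h1
  unfold clarksonDefect
  rw [norm_rpow_eq_sq_rpow r (a + b), norm_rpow_eq_sq_rpow r (a - b), norm_rpow_eq_sq_rpow r a,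
    norm_rpow_eq_sq_rpow r b]
  generalize ‖a‖ ^ 2 = x at *
  generalize ‖b‖ ^ 2 = y at *
  have e : ∀ z : ℝ, 0 < z → z ^ (r / 2) = z * z ^ (r / 2 - 1) := fun z hz => by
    rw [Real.rpow_sub_one hz.ne']; field_simp
  -- Superadditivity comes from writing `z ^ (r / 2)` as `z * z ^ (r / 2 - 1)` and comparing the
  -- second factors.
  have h2 : x ^ (r / 2 - 1) < (x + y) ^ (r / 2 - 1) :=
    Real.rpow_lt_rpow hx.le (by linarith) (by linarith)
  have h3 : y ^ (r / 2 - 1) < (x + y) ^ (r / 2 - 1) :=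
    Real.rpow_lt_rpow hy.le (by linarith) (by linarith)
  rw [e (x + y) (by linarith)] at h1
  rw [e x hx, e y hy]
  nlinarith [mul_lt_mul_of_pos_left h2 hx, mul_lt_mul_of_pos_left h3 hy]

/-- The mirror image of `clarksonDefect_pos`: below exponent `2` the power is concave and strictly
subadditive. -/
theorem clarksonDefect_neg {r : ℝ} (hr0 : 0 < r) (hr : r < 2) {a b : ℂ} (ha : a ≠ 0)
    (hb : b ≠ 0) : clarksonDefect r a b < 0 := by
  have hq : r / 2 < 1 := by linarith
  have hx : 0 < ‖a‖ ^ 2 := by positivity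
  have hy : 0 < ‖b‖ ^ 2 := by positivity
  have h1 := (Real.concaveOn_rpow (by linarith : 0 ≤ r / 2) hq.le).2 (sq_nonneg ‖a + b‖)
    (sq_nonneg ‖a - b‖)
    (by norm_num : (0 : ℝ) ≤ 1 / 2) (by norm_num : (0 : ℝ) ≤ 1 / 2) (by norm_num)
  rw [parallelogram_half] at h1
  simp only [smul_eq_mul] at h1
  unfold clarksonDefect
  rw [norm_rpow_eq_sq_rpow r (a + b), norm_rpow_eq_sq_rpow r (a - b), norm_rpow_eq_sq_rpow r a,
    norm_rpow_eq_sq_rpow r b]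
  generalize ‖a‖ ^ 2 = x at *
  generalize ‖b‖ ^ 2 = y at *
  have e : ∀ z : ℝ, 0 < z → z ^ (r / 2) = z * z ^ (r / 2 - 1) := fun z hz => by
    rw [Real.rpow_sub_one hz.ne']; field_simp
  have h2 : (x + y) ^ (r / 2 - 1) < x ^ (r / 2 - 1) :=
    Real.rpow_lt_rpow_of_neg hx (by linarith) (by linarith)
  have h3 : (x + y) ^ (r / 2 - 1) < y ^ (r / 2 - 1) :=
    Real.rpow_lt_rpow_of_neg hy (by linarith) (by linarith)
  rw [e (x + y) (by linarith)] at h1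
  rw [e x hx, e y hy]
  nlinarith [mul_lt_mul_of_pos_left h2 hx, mul_lt_mul_of_pos_left h3 hy]

variable {α : Type*} [MeasurableSpace α] {μ : Measure α} {p : ℝ≥0∞} [Fact (1 ≤ p)]

theorem Lp_integrable_norm_rpow (hp : p ≠ ∞) (f : Lp ℂ p μ) :
    Integrable (fun x => ‖f x‖ ^ p.toReal) μ :=
  (Lp.memLp f).integrable_norm_rpow (zero_lt_one.trans_le Fact.out).ne' hp

theorem Lp_norm_rpow_eq_integral (hp : p ≠ ∞) (f : Lp ℂ p μ) :
    ‖f‖ ^ p.toReal = ∫ x, ‖f x‖ ^ p.toReal ∂μ := by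
  have h0 : p ≠ 0 := (zero_lt_one.trans_le (Fact.out : 1 ≤ p)).ne'
  have h1 : 0 < p.toReal := ENNReal.toReal_pos h0 hp
  rw [Lp.norm_def, (Lp.memLp f).eLpNorm_eq_integral_rpow_norm h0 hp, ENNReal.toReal_ofReal
    (by positivity), ← Real.rpow_mul (by positivity), inv_mul_cancel₀ h1.ne', Real.rpow_one]

/-- Two elements of `L^p`, `p ≠ 2`, are disjoint if and only if their Clarkson defect vanishes. -/
theorem ae_disjoint_iff_clarksonDefect (hp : p ≠ ∞) (hp2 : p ≠ 2) (f g : Lp ℂ p μ) :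
    (∀ᵐ x ∂μ, f x = 0 ∨ g x = 0) ↔ clarksonDefect p.toReal f g = 0 := by
  have h0 : p ≠ 0 := (zero_lt_one.trans_le (Fact.out : 1 ≤ p)).ne'
  have hr : 0 < p.toReal := ENNReal.toReal_pos h0 hp
  have hr2 : p.toReal ≠ 2 := fun h => hp2 (by
    rw [← ENNReal.ofReal_toReal hp, h]; simp)
  have h1 := Lp_integrable_norm_rpow hp (f + g)
  have h2 := Lp_integrable_norm_rpow hp (f - g)
  have h3 := (Lp_integrable_norm_rpow hp f).const_mul 2
  have h4 := (Lp_integrable_norm_rpow hp g).const_mul 2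
  have h12 : Integrable (fun x => ‖(f + g) x‖ ^ p.toReal + ‖(f - g) x‖ ^ p.toReal) μ := h1.add h2
  have h123 : Integrable (fun x => ‖(f + g) x‖ ^ p.toReal + ‖(f - g) x‖ ^ p.toReal
    - 2 * ‖f x‖ ^ p.toReal) μ := h12.sub h3
  have hae : (fun x => ‖(f + g) x‖ ^ p.toReal + ‖(f - g) x‖ ^ p.toReal - 2 * ‖f x‖ ^ p.toReal
      - 2 * ‖g x‖ ^ p.toReal) =ᵐ[μ] fun x => clarksonDefect p.toReal (f x) (g x) := by
    filter_upwards [Lp.coeFn_add f g, Lp.coeFn_sub f g] with x h5 h6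
    rw [h5, h6]; rfl
  have hi : Integrable (fun x => clarksonDefect p.toReal (f x) (g x)) μ :=
    (h123.sub h4).congr hae
  have hD : clarksonDefect p.toReal f g = ∫ x, clarksonDefect p.toReal (f x) (g x) ∂μ := by
    rw [clarksonDefect, Lp_norm_rpow_eq_integral hp, Lp_norm_rpow_eq_integral hp,
      Lp_norm_rpow_eq_integral hp, Lp_norm_rpow_eq_integral hp, ← integral_add h1 h2,
      ← integral_const_mul, ← integral_const_mul, ← integral_sub h12 h3, ← integral_sub h123 h4,
      integral_congr_ae hae]
  rw [hD]
  constructor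
  · intro h
    refine integral_eq_zero_of_ae ?_
    filter_upwards [h] with x hx using clarksonDefect_of_eq_zero hr hx
  · intro h
    have h7 : (fun x => clarksonDefect p.toReal (f x) (g x)) =ᵐ[μ] 0 := by
      rcases lt_or_gt_of_ne hr2 with h2 | h2
      · have hneg : ∀ x, 0 ≤ -clarksonDefect p.toReal (f x) (g x) := fun x => by
          by_cases hx : f x = 0 ∨ g x = 0
          · rw [clarksonDefect_of_eq_zero hr hx, neg_zero]
          · push Not at hx
            exact neg_nonneg.2 (clarksonDefect_neg hr h2 hx.1 hx.2).le
        have := (integral_eq_zero_iff_of_nonneg hneg hi.neg).1 (by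
          rw [integral_neg, h, neg_zero])
        filter_upwards [this] with x hx
        simpa using hx
      · refine (integral_eq_zero_iff_of_nonneg (fun x => ?_) hi).1 h
        by_cases hx : f x = 0 ∨ g x = 0
        · rw [clarksonDefect_of_eq_zero hr hx]; rfl
        · push Not at hx
          exact (clarksonDefect_pos h2 hx.1 hx.2).le
    filter_upwards [h7] with x hx
    by_contra! hc
    rcases lt_or_gt_of_ne hr2 with h2 | h2
    · exact (clarksonDefect_neg hr h2 hc.1 hc.2).ne hx
    · exact (clarksonDefect_pos h2 hc.1 hc.2).ne' hx

/-- **Lamperti's theorem**: for `p ≠ 2`, isometries of `L^p` preserve disjointness. -/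
theorem ae_disjoint_of_isometry (hp : p ≠ ∞) (hp2 : p ≠ 2) (T : Lp ℂ p μ →L[ℂ] Lp ℂ p μ)
    (hT : ∀ ξ, ‖T ξ‖ = ‖ξ‖) {f g : Lp ℂ p μ} (h : ∀ᵐ x ∂μ, f x = 0 ∨ g x = 0) :
    ∀ᵐ x ∂μ, T f x = 0 ∨ T g x = 0 := by
  rw [ae_disjoint_iff_clarksonDefect hp hp2] at h ⊢
  rw [← h]
  -- The defect involves only norms of `f`, `g`, `f + g` and `f - g`, all preserved by a linear
  -- isometry.
  simp only [clarksonDefect, ← map_add, ← map_sub, hT]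

end Lamperti

/-! ### Compactly supported continuous functions in `L^p` -/

section Dense

variable {X : Type*} [TopologicalSpace X] [T2Space X] [LocallyCompactSpace X] [MeasurableSpace X]
  [BorelSpace X]

/-- In a locally compact space, the compactly supported continuous functions are dense in `L^p`. -/
theorem exists_compactlySupported_eLpNorm_sub_le {μ : Measure X} [IsFiniteMeasureOnCompacts μ]
    [μ.InnerRegularCompactLTTop] {p : ℝ≥0∞} (hp : p ≠ ∞) {f : X → ℂ} (hf : MemLp f p μ)
    {ε : ℝ≥0∞} (hε : ε ≠ 0) :
    ∃ g : C_c(X, ℂ), eLpNorm (f - ⇑g) p μ ≤ ε := by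
  suffices H : ∃ g : X → ℂ, eLpNorm (f - g) p μ ≤ ε ∧ ∃ g' : C_c(X, ℂ), ⇑g' = g by
    obtain ⟨_, hg, g', rfl⟩ := H
    exact ⟨g', hg⟩
  refine hf.induction_dense hp _ ?_ ?_ ?_ hε
  · intro c t ht htμ ε hε
    obtain ⟨δ, δpos, hδ⟩ := exists_Lp_half ℂ μ p hε
    obtain ⟨η, ηpos, hη⟩ :
        ∃ η : ℝ≥0, 0 < η ∧ ∀ s : Set X, μ s ≤ η → eLpNorm (s.indicator fun _x => c) p μ ≤ δ :=
      exists_eLpNorm_indicator_le hp c δpos.ne'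
    have hη0 : (0 : ℝ≥0∞) < η := ENNReal.coe_pos.2 ηpos
    -- The indicator of `t` is squeezed between a compact `s` inside `t` and an open `V` around `s`,
    -- each leaving an error set of measure at most `η`; a bump function equal to `1` on `s` and `0`
    -- off `V` does the rest. `V` need not contain `t`.
    obtain ⟨s, st, s_compact, s_closed, μs⟩ :
        ∃ s, s ⊆ t ∧ IsCompact s ∧ IsClosed s ∧ μ (t \ s) < η :=
      ht.exists_isCompact_isClosed_sdiff_lt htμ.ne hη0.ne'
    obtain ⟨V, sV, V_open, hV⟩ := s_compact.exists_isOpen_lt_add (μ := μ) hη0.ne'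
    have hVs : μ (V \ s) ≤ η := by
      rw [measure_sdiff sV s_closed.measurableSet.nullMeasurableSet s_compact.measure_lt_top.ne]
      exact tsub_le_iff_left.2 hV.le
    obtain ⟨g, hg1, hg0, hgc, hg⟩ := exists_continuous_one_zero_of_isCompact s_compact
      V_open.isClosed_compl (Set.disjoint_compl_right_iff_subset.2 sV)
    let g' : C_c(X, ℂ) := ⟨⟨fun x => (g x : ℂ) * c, by fun_prop⟩, by
      exact hgc.mono (fun x hx => by
        simp only [Function.mem_support] at hx ⊢
        contrapose! hx; simp [hx])⟩
    refine ⟨g', ?_, g', rfl⟩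
    have h1 : eLpNorm (⇑g' - s.indicator fun _ => c) p μ ≤ δ := by
      refine (eLpNorm_mono fun x => ?_).trans (hη _ hVs)
      change ‖(g x : ℂ) * c - s.indicator (fun _ => c) x‖ ≤ _
      by_cases hxs : x ∈ s
      · simp [hxs, hg1 hxs]
      · by_cases hxV : x ∈ V
        · have h01 := hg x
          simp only [hxs, not_false_eq_true, Set.indicator_of_notMem, sub_zero, norm_mul,
            Complex.norm_real, Real.norm_eq_abs, abs_of_nonneg h01.1]
          rw [Set.indicator_of_mem (show x ∈ V \ s from ⟨hxV, hxs⟩)]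
          exact mul_le_of_le_one_left (norm_nonneg _) h01.2
        · simp [hxs, hg0 (show x ∈ Vᶜ from hxV)]
    have h2 : eLpNorm ((s.indicator fun _ => c) - t.indicator fun _ => c) p μ ≤ δ := by
      rw [← eLpNorm_neg, neg_sub, ← Set.indicator_sdiff st]
      exact hη _ μs.le
    have h3 := (hδ _ _ ((g'.continuous.memLp_of_hasCompactSupport
      (p := p) g'.hasCompactSupport).aestronglyMeasurable.sub
      (aestronglyMeasurable_const.indicator s_closed.measurableSet))
      ((aestronglyMeasurable_const.indicator s_closed.measurableSet).sub
      (aestronglyMeasurable_const.indicator ht)) h1 h2).le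
    rwa [sub_add_sub_cancel] at h3
  · rintro _ _ ⟨f, rfl⟩ ⟨g, rfl⟩
    exact ⟨f + g, rfl⟩
  · rintro _ ⟨f, rfl⟩
    exact (f.continuous.memLp_of_hasCompactSupport (p := p) f.hasCompactSupport).aestronglyMeasurable

variable (p : ℝ≥0∞) (μ : Measure X) [IsFiniteMeasureOnCompacts μ]

/-- The class in `L^p` of a compactly supported continuous function. -/
noncomputable def ccLp (f : C_c(X, ℂ)) : Lp ℂ p μ :=
  (f.continuous.memLp_of_hasCompactSupport f.hasCompactSupport).toLp f

theorem coeFn_ccLp (f : C_c(X, ℂ)) : ccLp p μ f =ᵐ[μ] f := MemLp.coeFn_toLp _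

theorem denseRange_ccLp [μ.InnerRegularCompactLTTop] [Fact (1 ≤ p)] (hp : p ≠ ∞) :
    DenseRange (ccLp p μ) := by
  intro u
  rw [Metric.mem_closure_iff]
  intro ε hε
  obtain ⟨g, hg⟩ := exists_compactlySupported_eLpNorm_sub_le hp (Lp.memLp u)
    (ε := ENNReal.ofReal (ε / 2)) (by simpa using hε)
  refine ⟨_, ⟨g, rfl⟩, ?_⟩
  rw [dist_eq_norm, Lp.norm_def]
  have h : eLpNorm (u - ccLp p μ g : Lp ℂ p μ) p μ = eLpNorm (⇑u - ⇑g) p μ := by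
    refine eLpNorm_congr_ae ?_
    filter_upwards [Lp.coeFn_sub u (ccLp p μ g), coeFn_ccLp p μ g] with x h1 h2
    rw [h1]; simp [h2]
  rw [h]
  calc _ ≤ (ENNReal.ofReal (ε / 2)).toReal := ENNReal.toReal_mono ENNReal.ofReal_ne_top hg
    _ = ε / 2 := ENNReal.toReal_ofReal (by positivity)
    _ < ε := by linarith

variable {p μ}

/-- The continuous functional on `L^p` given by integration against an element of `L^q`. -/
noncomputable def lpFunctional {q : ℝ≥0∞} [Fact (1 ≤ p)] [Fact (1 ≤ q)]
    [ENNReal.HolderConjugate p q]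
    (v : Lp ℂ q μ) : StrongDual ℂ (Lp ℂ p μ) :=
  ((ContinuousLinearMap.mul ℂ ℂ).lpPairing μ p q).flip v

theorem lpFunctional_apply {q : ℝ≥0∞} [Fact (1 ≤ p)] [Fact (1 ≤ q)]
    [ENNReal.HolderConjugate p q] (v : Lp ℂ q μ) (u : Lp ℂ p μ) :
    lpFunctional v u = ∫ x, u x * v x ∂μ := by
  rw [lpFunctional, ContinuousLinearMap.flip_apply, ContinuousLinearMap.lpPairing_eq_integral]
  rfl

theorem lpFunctional_ccLp {q : ℝ≥0∞} [Fact (1 ≤ p)] [Fact (1 ≤ q)]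
    [ENNReal.HolderConjugate p q] (η : C_c(X, ℂ)) (u : Lp ℂ p μ) :
    lpFunctional (ccLp q μ η) u = ∫ x, u x * η x ∂μ := by
  rw [lpFunctional_apply]
  refine integral_congr_ae ?_
  filter_upwards [coeFn_ccLp q μ η] with x hx
  rw [hx]

theorem lpFunctional_indicatorConstLp {q : ℝ≥0∞} [Fact (1 ≤ p)] [Fact (1 ≤ q)]
    [ENNReal.HolderConjugate p q] {s : Set X} (hs : MeasurableSet s) (hsμ : μ s ≠ ∞)
    (u : Lp ℂ p μ) :
    lpFunctional (indicatorConstLp q hs hsμ 1) u = ∫ x in s, u x ∂μ := by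
  rw [lpFunctional_apply, ← integral_indicator hs]
  refine integral_congr_ae ?_
  filter_upwards [indicatorConstLp_coeFn (p := q) (hs := hs) (hμs := hsμ) (c := (1 : ℂ))] with x hx
  rw [hx]
  by_cases h : x ∈ s <;> simp [h]

theorem integrableOn_Lp [Fact (1 ≤ p)] (u : Lp ℂ p μ) {s : Set X} (hs : μ s ≠ ∞) :
    IntegrableOn u s μ :=
  haveI : IsFiniteMeasure (μ.restrict s) := ⟨by simpa [lt_top_iff_ne_top] using hs⟩
  ((Lp.memLp u).restrict s).integrable Fact.out

/-- The functionals given by compactly supported continuous functions separate the points of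
`L^p`. -/
theorem eq_of_forall_lpFunctional_ccLp [μ.InnerRegularCompactLTTop] {q : ℝ≥0∞} [Fact (1 ≤ p)]
    [Fact (1 ≤ q)] [ENNReal.HolderConjugate p q] (hp : p ≠ ∞) (hq : q ≠ ∞) {u v : Lp ℂ p μ}
    (h : ∀ η : C_c(X, ℂ), lpFunctional (ccLp q μ η) u = lpFunctional (ccLp q μ η) v) : u = v := by
  have h1 : ∀ w : Lp ℂ q μ, lpFunctional w u = lpFunctional w v := by
    intro w
    have := (denseRange_ccLp q μ hq).equalizer
      ((ContinuousLinearMap.lpPairing μ p q (ContinuousLinearMap.mul ℂ ℂ)) u).continuous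
      ((ContinuousLinearMap.lpPairing μ p q (ContinuousLinearMap.mul ℂ ℂ)) v).continuous
      (funext h)
    exact congrFun this w
  have h0 : p ≠ 0 := (zero_lt_one.trans_le (Fact.out : 1 ≤ p)).ne'
  refine Lp.ext (Lp.ae_eq_of_forall_setIntegral_eq u v h0 hp ?_ ?_ ?_)
  · intro s _ hsμ
    exact integrableOn_Lp u hsμ.ne
  · intro s _ hsμ
    exact integrableOn_Lp v hsμ.ne
  · intro s hs hsμ
    simpa only [lpFunctional_indicatorConstLp] using h1 (indicatorConstLp q hs hsμ.ne 1)

end Dense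

/-! ### The regular representations are strongly continuous -/

section RegularContinuity

variable {G : Type*} [Group G] [TopologicalSpace G] [IsTopologicalGroup G]
  [LocallyCompactSpace G] [MeasurableSpace G] [BorelSpace G]
  (p : ℝ≥0∞) [Fact (1 ≤ p)] (μ : Measure G) [IsLeftHaar μ]

/-- Both meanings of "Radon" give compact inner regularity on sets of finite measure, which is what
the approximation arguments need. -/
instance : μ.InnerRegularCompactLTTop := by
  rcases IsLeftHaar.radon (μ := μ) with h | h <;> infer_instance

theorem coeFn_leftRegular (s : G) (ξ : Lp ℂ p μ) :
    leftRegular p μ s ξ =ᵐ[μ] fun t => ξ (s⁻¹ * t) :=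
  Lp.coeFn_compMeasurePreserving ξ (measurePreserving_mul_left μ s⁻¹)

theorem norm_leftRegular_apply (s : G) (ξ : Lp ℂ p μ) : ‖leftRegular p μ s ξ‖ = ‖ξ‖ :=
  Lp.norm_compMeasurePreserving ξ (measurePreserving_mul_left μ s⁻¹)

theorem leftRegular_mul_apply (s t : G) (ξ : Lp ℂ p μ) :
    leftRegular p μ (s * t) ξ = leftRegular p μ s (leftRegular p μ t ξ) := by
  refine Lp.ext ?_
  have h1 := (measurePreserving_mul_left μ s⁻¹).quasiMeasurePreserving.ae_eq_comp
    (coeFn_leftRegular p μ t ξ)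
  filter_upwards [coeFn_leftRegular p μ (s * t) ξ, coeFn_leftRegular p μ s (leftRegular p μ t ξ),
    h1] with x h2 h3 h4
  rw [h2, h3]
  simp only [Function.comp_apply] at h4
  rw [h4, mul_inv_rev, mul_assoc]

theorem leftRegular_one_apply (ξ : Lp ℂ p μ) : leftRegular p μ 1 ξ = ξ := by
  refine Lp.ext ?_
  filter_upwards [coeFn_leftRegular p μ 1 ξ] with x h
  rw [h]; simp

theorem continuous_leftRegular (hp : p ≠ ∞) (ξ : Lp ℂ p μ) :
    Continuous fun s => leftRegular p μ s ξ := by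
  let F : C(G × G, G) := ⟨fun q => q.1⁻¹ * q.2, by fun_prop⟩
  exact Continuous.compMeasurePreservingLp (f := fun _ : G => ξ) (g := fun s => F.curry s)
    continuous_const F.curry.continuous (fun s => measurePreserving_mul_left μ s⁻¹) hp

theorem coeFn_rightRegular (s : G) (ξ : Lp ℂ p μ) :
    rightRegular p μ s ξ =ᵐ[μ] fun t => ξ (t * s) :=
  MemLp.coeFn_toLp (memLp_comp_mul_right p μ s ξ)

theorem leftRegular_rightRegular (s t : G) (ξ : Lp ℂ p μ) :
    leftRegular p μ s (rightRegular p μ t ξ) = rightRegular p μ t (leftRegular p μ s ξ) := by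
  refine Lp.ext ?_
  have h1 := (measurePreserving_mul_left μ s⁻¹).quasiMeasurePreserving.ae_eq_comp
    (coeFn_rightRegular p μ t ξ)
  have h2 := (quasiMeasurePreserving_mul_right' μ t).ae_eq_comp (coeFn_leftRegular p μ s ξ)
  filter_upwards [coeFn_leftRegular p μ s (rightRegular p μ t ξ),
    coeFn_rightRegular p μ t (leftRegular p μ s ξ), h1, h2] with x h3 h4 h5 h6
  simp only [Function.comp_apply] at h5 h6
  rw [h3, h4, h5, h6, mul_assoc]

/-- The factor `c` is the modular function at `s` in some normalization. It equals `∫ f (x * s) / ∫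
f` for a fixed bump function `f`, and the numerator is continuous in `s`, hence bounded on `K`. -/
theorem exists_bound_map_mul_right {K : Set G} (hK : IsCompact K) :
    ∃ M : ℝ≥0, ∀ s ∈ K, ∃ c : ℝ≥0, c ≤ M ∧ μ.map (· * s) = c • μ := by
  obtain ⟨f, f_comp, f_nonneg, f_one⟩ := exists_continuous_nonneg_pos (1 : G)
  have hI : 0 < ∫ x, f x ∂μ :=
    f.continuous.integral_pos_of_hasCompactSupport_nonneg_nonzero f_comp f_nonneg f_one
  have hcont : ContinuousOn (fun s => ∫ x, f (x * s) ∂μ) K := by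
    have hk : IsCompact (tsupport f * K⁻¹) := IsCompact.mul f_comp hK.inv
    refine continuousOn_integral_of_compact_support hk (f := fun s x => f (x * s)) ?_ ?_
    · exact (f.continuous.comp (continuous_snd.mul continuous_fst)).continuousOn
    · intro s x hs hx
      by_contra hne
      exact hx ⟨x * s, subset_tsupport _ hne, s⁻¹, by simpa using hs, by simp⟩
  obtain ⟨M, hM⟩ := hK.bddAbove_image hcont
  refine ⟨(M / ∫ x, f x ∂μ).toNNReal, fun s hs => ?_⟩
  obtain ⟨c, -, hc⟩ := map_mul_right_eq μ s
  refine ⟨c, ?_, hc⟩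
  have h1 : ∫ x, f (x * s) ∂μ = c * ∫ x, f x ∂μ := by
    have := integral_map (μ := μ) (φ := (· * s)) (measurable_mul_const s).aemeasurable
      (f := f) (hfm := by
        rw [hc]
        exact ((f.continuous.memLp_of_hasCompactSupport (p := 1)
          f_comp).aestronglyMeasurable).mono_ac Measure.smul_absolutelyContinuous)
    rw [← this, hc, integral_smul_nnreal_measure]; rfl
  have h2 : (c : ℝ) * ∫ x, f x ∂μ ≤ M := by
    rw [← h1]; exact hM ⟨s, hs, rfl⟩
  rw [← NNReal.coe_le_coe]
  exact ((le_div_iff₀ hI).2 h2).trans (Real.le_coe_toNNReal _)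

/-- The right regular representation is bounded on compact sets. -/
theorem exists_bound_rightRegular {K : Set G} (hK : IsCompact K) :
    ∃ C : ℝ, 0 ≤ C ∧ ∀ s ∈ K, ∀ ξ : Lp ℂ p μ, ‖rightRegular p μ s ξ‖ ≤ C * ‖ξ‖ := by
  obtain ⟨M, hM⟩ := exists_bound_map_mul_right μ hK
  refine ⟨((M : ℝ≥0∞) ^ (1 / p).toReal).toReal, ENNReal.toReal_nonneg, fun s hs ξ => ?_⟩
  obtain ⟨c, hcM, hc⟩ := hM s hs
  have hm : MeasurePreserving (· * s) μ (c • μ) := ⟨measurable_mul_const s, hc⟩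
  have h1 : AEStronglyMeasurable ξ (c • μ) :=
    (Lp.aestronglyMeasurable ξ).mono_ac Measure.smul_absolutelyContinuous
  have h2 := eLpNorm_comp_measurePreserving (p := p) h1 hm
  rw [Lp.norm_def, Lp.norm_def, ← ENNReal.toReal_mul]
  refine ENNReal.toReal_mono (ENNReal.mul_ne_top (ENNReal.rpow_ne_top_of_nonneg
    ENNReal.toReal_nonneg ENNReal.coe_ne_top) (Lp.memLp ξ).2.ne) ?_
  rw [eLpNorm_congr_ae (coeFn_rightRegular p μ s ξ)]
  change eLpNorm (ξ ∘ (· * s)) p μ ≤ _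
  rw [h2]
  refine (eLpNorm_smul_measure_le (c : ℝ≥0∞) ξ p μ).trans ?_
  rw [smul_eq_mul]
  gcongr

variable [T2Space G]

/-- For `s` in a compact neighbourhood `N` of `s₀`, all the translates of `f` live on the compact
set `k = tsupport f * N⁻¹`. The tube lemma makes them uniformly `δ`-close there, so the `L^p`
distance is at most `δ μ(k) ^ (1 / p)`. -/
theorem continuous_rightRegular_ccLp (hp : p ≠ ∞) (f : C_c(G, ℂ)) :
    Continuous fun s => rightRegular p μ s (ccLp p μ f) := by
  rw [continuous_iff_continuousAt]
  intro s₀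
  obtain ⟨N, hN, hNs⟩ := exists_compact_mem_nhds s₀
  have hk : IsCompact (tsupport f * N⁻¹) := IsCompact.mul f.hasCompactSupport hN.inv
  set k := tsupport f * N⁻¹ with hkdef
  have hfin : μ k < ∞ := hk.measure_lt_top
  rw [ContinuousAt, Metric.tendsto_nhds]
  intro ε hε
  obtain ⟨δ, hδ0, hδ⟩ : ∃ δ : ℝ, 0 < δ ∧ δ * (μ k).toReal ^ p.toReal⁻¹ < ε := by
    have ht : Filter.Tendsto (fun δ : ℝ => δ * (μ k).toReal ^ p.toReal⁻¹) (𝓝[>] 0) (𝓝 0) := by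
      have : Continuous fun δ : ℝ => δ * (μ k).toReal ^ p.toReal⁻¹ := by fun_prop
      have h := this.tendsto 0
      rw [zero_mul] at h
      exact h.mono_left nhdsWithin_le_nhds
    obtain ⟨δ, h1, h2⟩ := ((ht.eventually (gt_mem_nhds hε)).and self_mem_nhdsWithin).exists
    exact ⟨δ, h2, h1⟩
  have hopen : IsOpen {q : G × G | dist (f (q.1 * q.2)) (f (q.1 * s₀)) < δ} := by
    have hf := f.continuous
    exact isOpen_lt (by fun_prop) continuous_const
  obtain ⟨U, V, -, hV, hU', hV', hUV⟩ := generalized_tube_lemma hk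
    (isCompact_singleton (x := s₀)) hopen (by
      rintro ⟨t, s⟩ ⟨-, rfl⟩
      simpa using hδ0)
  filter_upwards [hNs, hV.mem_nhds (hV' rfl)] with s hsN hsV
  have hbound : ∀ᵐ t ∂μ, ‖(rightRegular p μ s (ccLp p μ f) - rightRegular p μ s₀ (ccLp p μ f) :
      Lp ℂ p μ) t‖ ≤ ‖k.indicator (fun _ => δ) t‖ := by
    filter_upwards [Lp.coeFn_sub (rightRegular p μ s (ccLp p μ f))
      (rightRegular p μ s₀ (ccLp p μ f)), coeFn_rightRegular p μ s (ccLp p μ f),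
      coeFn_rightRegular p μ s₀ (ccLp p μ f),
      (quasiMeasurePreserving_mul_right' μ s).ae_eq_comp (coeFn_ccLp p μ f),
      (quasiMeasurePreserving_mul_right' μ s₀).ae_eq_comp (coeFn_ccLp p μ f)] with t h1 h2 h3 h4 h5
    simp only [Function.comp_apply] at h4 h5
    rw [h1, Pi.sub_apply, h2, h3, h4, h5]
    by_cases ht : t ∈ k
    · have := hUV (show (t, s) ∈ U ×ˢ V from ⟨hU' ht, hsV⟩)
      rw [Set.indicator_of_mem ht, Real.norm_of_nonneg hδ0.le, ← dist_eq_norm]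
      exact le_of_lt this
    · have hz : ∀ r ∈ N, f (t * r) = 0 := fun r hr => by
        by_contra hne
        exact ht ⟨t * r, subset_tsupport _ hne, r⁻¹, by simpa using hr, by simp⟩
      rw [hz s hsN, hz s₀ (mem_of_mem_nhds hNs)]
      simp
  have h0 : p ≠ 0 := (zero_lt_one.trans_le (Fact.out : 1 ≤ p)).ne'
  rw [dist_eq_norm, Lp.norm_def]
  refine lt_of_le_of_lt ?_ hδ
  calc _ ≤ (eLpNorm (k.indicator fun _ => δ) p μ).toReal := by
        refine ENNReal.toReal_mono ?_ (eLpNorm_mono_ae hbound)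
        exact (memLp_indicator_const p hk.measurableSet δ (Or.inr hfin.ne)).2.ne
    _ = _ := by
        rw [eLpNorm_indicator_const hk.measurableSet h0 hp, ENNReal.toReal_mul, toReal_enorm,
          Real.norm_of_nonneg hδ0.le, ENNReal.toReal_rpow, one_div]

/-- Right translations need not be isometric, so the usual `ε / 3` approximation uses their uniform
bound on a compact neighbourhood. -/
theorem continuous_rightRegular (hp : p ≠ ∞) (ξ : Lp ℂ p μ) :
    Continuous fun s => rightRegular p μ s ξ := by
  rw [continuous_iff_continuousAt]
  intro s₀
  obtain ⟨N, hN, hNs⟩ := exists_compact_mem_nhds s₀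
  obtain ⟨C, hC0, hC⟩ := exists_bound_rightRegular p μ hN
  rw [ContinuousAt, Metric.tendsto_nhds]
  intro ε hε
  obtain ⟨δ, hδ0, hδ⟩ : ∃ δ : ℝ, 0 < δ ∧ C * δ < ε / 3 := by
    refine ⟨ε / (3 * (C + 1)), by positivity, ?_⟩
    rw [← mul_div_assoc, div_lt_div_iff₀ (by positivity) (by positivity)]
    nlinarith
  obtain ⟨f, hf⟩ := (denseRange_ccLp p μ hp).exists_dist_lt ξ hδ0
  have h1 : ∀ s ∈ N, dist (rightRegular p μ s ξ) (rightRegular p μ s (ccLp p μ f)) < ε / 3 := by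
    intro s hs
    rw [dist_eq_norm, ← map_sub]
    refine (hC s hs _).trans_lt (lt_of_le_of_lt ?_ hδ)
    rw [← dist_eq_norm]
    gcongr
  have h2 := Metric.tendsto_nhds.1 ((continuous_rightRegular_ccLp p μ hp f).tendsto s₀) (ε / 3)
    (by positivity)
  filter_upwards [hNs, h2] with s hs h3
  have h4 := h1 s hs
  have h5 := h1 s₀ (mem_of_mem_nhds hNs)
  rw [dist_comm] at h5
  calc _ ≤ _ := dist_triangle4 _ (rightRegular p μ s (ccLp p μ f))
        (rightRegular p μ s₀ (ccLp p μ f)) _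
    _ < ε := by linarith

end RegularContinuity

/-! ### Convolution as an average of left, and of right, translates -/

section Convolution

variable {G : Type*} [Group G] [TopologicalSpace G] [IsTopologicalGroup G]
  [LocallyCompactSpace G] [T2Space G] [MeasurableSpace G] [BorelSpace G]
  {p q : ℝ≥0∞} [Fact (1 ≤ p)] [Fact (1 ≤ q)] [ENNReal.HolderConjugate p q]
  {μ : Measure G} [IsLeftHaar μ]

theorem lpFunctional_leftRegular_ccLp (g η : C_c(G, ℂ)) (s : G) :
    lpFunctional (ccLp q μ η) (leftRegular p μ s (ccLp p μ g)) = ∫ t, g (s⁻¹ * t) * η t ∂μ := by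
  rw [lpFunctional_ccLp]
  refine integral_congr_ae ?_
  filter_upwards [coeFn_leftRegular p μ s (ccLp p μ g),
    (measurePreserving_mul_left μ s⁻¹).quasiMeasurePreserving.ae_eq_comp (coeFn_ccLp p μ g)]
    with t h1 h2
  simp only [Function.comp_apply] at h2
  rw [h1, h2]

theorem lpFunctional_rightRegular_ccLp (f η : C_c(G, ℂ)) (s : G) :
    lpFunctional (ccLp q μ η) (rightRegular p μ s (ccLp p μ f)) = ∫ t, f (t * s) * η t ∂μ := by
  rw [lpFunctional_ccLp]
  refine integral_congr_ae ?_
  filter_upwards [coeFn_rightRegular p μ s (ccLp p μ f),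
    (quasiMeasurePreserving_mul_right' μ s).ae_eq_comp (coeFn_ccLp p μ f)] with t h1 h2
  simp only [Function.comp_apply] at h2
  rw [h1, h2]

variable (p q μ) in
/-- The matrix coefficient `s ↦ ⟨λ_p(s) g, η⟩` of two compactly supported continuous functions. -/
noncomputable def ccCoefficient (hp : p ≠ ∞) (g η : C_c(G, ℂ)) : C_c(G, ℂ) where
  toFun s := lpFunctional (ccLp q μ η) (leftRegular p μ s (ccLp p μ g))
  continuous_toFun := (lpFunctional (ccLp q μ η)).continuous.comp
    (continuous_leftRegular p μ hp _)
  hasCompactSupport' := by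
    refine HasCompactSupport.intro (IsCompact.mul η.hasCompactSupport
      (IsCompact.inv g.hasCompactSupport)) fun s hs => ?_
    rw [lpFunctional_leftRegular_ccLp]
    refine integral_eq_zero_of_ae (Filter.Eventually.of_forall fun t => ?_)
    by_contra hne
    simp only [Pi.zero_apply, mul_eq_zero, not_or] at hne
    exact hs ⟨t, subset_tsupport _ hne.2, (s⁻¹ * t)⁻¹,
      Set.inv_mem_inv.2 (subset_tsupport _ hne.1), by simp⟩

theorem ccCoefficient_apply (hp : p ≠ ∞) (g η : C_c(G, ℂ)) (s : G) :
    ccCoefficient p q μ hp g η s = ∫ t, g (s⁻¹ * t) * η t ∂μ :=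
  lpFunctional_leftRegular_ccLp g η s

theorem hasCompactSupport_comp_inv (g : C_c(G, ℂ)) : HasCompactSupport fun s => g s⁻¹ :=
  g.hasCompactSupport.comp_homeomorph (Homeomorph.inv G)

theorem integrable_smul_rightRegular (hp : p ≠ ∞) (g : C_c(G, ℂ)) (u : Lp ℂ p μ) :
    Integrable (fun s => g s⁻¹ • rightRegular p μ s u) μ := by
  have hg := g.continuous
  have hu := continuous_rightRegular p μ hp u
  exact Continuous.integrable_of_hasCompactSupport (by fun_prop)
    ((hasCompactSupport_comp_inv g).smul_right)

theorem integrable_mul_functional_rightRegular (hp : p ≠ ∞) (g : C_c(G, ℂ))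
    (φ : StrongDual ℂ (Lp ℂ p μ)) (u : Lp ℂ p μ) :
    Integrable (fun s => g s⁻¹ * φ (rightRegular p μ s u)) μ := by
  have := φ.integrable_comp (integrable_smul_rightRegular hp g u)
  simpa using this

/-- Only `s` in the inverse of the support of `g` contribute, and there the right translations are
uniformly bounded; the integral is therefore Lipschitz in `u`. This lets identities pass from `C_c`
to `L^p`. -/
theorem continuous_integral_functional_rightRegular (hp : p ≠ ∞) (g : C_c(G, ℂ))
    (φ : StrongDual ℂ (Lp ℂ p μ)) :
    Continuous fun u => ∫ s, g s⁻¹ * φ (rightRegular p μ s u) ∂μ := by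
  obtain ⟨C, hC0, hC⟩ := exists_bound_rightRegular p μ (IsCompact.inv g.hasCompactSupport)
  have hgi : Integrable (fun s => g s⁻¹) μ := by
    have hg := g.continuous
    exact Continuous.integrable_of_hasCompactSupport (by fun_prop) (hasCompactSupport_comp_inv g)
  refine (LipschitzWith.of_dist_le' (K := (∫ s, ‖g s⁻¹‖ ∂μ) * (‖φ‖ * C)) fun u v => ?_).continuous
  rw [dist_eq_norm, ← integral_sub (integrable_mul_functional_rightRegular hp g φ u)
    (integrable_mul_functional_rightRegular hp g φ v), mul_assoc, ← integral_mul_const]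
  refine norm_integral_le_of_norm_le (hgi.norm.mul_const _) (Filter.Eventually.of_forall fun s => ?_)
  rw [← mul_sub, ← map_sub, ← map_sub, norm_mul, dist_eq_norm]
  by_cases hs : g s⁻¹ = 0
  · simp [hs]
  · have h1 := hC s (by simpa using subset_tsupport _ hs) (u - v)
    rw [mul_assoc]
    gcongr
    exact (φ.le_opNorm _).trans (by gcongr)

/-- Both sides become double integrals. After swapping, left invariance under `s ↦ t * s` matches
the inner integrals. Compact supports justify the swap without σ-finiteness of `μ`. -/
theorem integral_functional_rightRegular_ccLp (hp : p ≠ ∞) (f g η : C_c(G, ℂ)) :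
    ∫ s, g s⁻¹ * lpFunctional (ccLp q μ η) (rightRegular p μ s (ccLp p μ f)) ∂μ
      = ∫ s, f s * ccCoefficient p q μ hp g η s ∂μ := by
  have hf := f.continuous
  have hg := g.continuous
  have hη := η.continuous
  simp_rw [lpFunctional_rightRegular_ccLp, ccCoefficient_apply, ← integral_const_mul]
  rw [integral_integral_swap_of_hasCompactSupport
    (f := fun s t => g s⁻¹ * (f (t * s) * η t)) (by dsimp only [Function.uncurry_def]; fun_prop),
    integral_integral_swap_of_hasCompactSupport
    (f := fun s t => f s * (g (s⁻¹ * t) * η t)) (by dsimp only [Function.uncurry_def]; fun_prop)]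
  · refine integral_congr_ae (Filter.Eventually.of_forall fun t => ?_)
    have := integral_mul_left_eq_self (μ := μ) (fun s => f s * (g (s⁻¹ * t) * η t)) t
    simp only at this ⊢
    rw [← this]
    congr 1 with s
    simp only [mul_inv_rev, inv_mul_cancel_right]
    ring
  · refine HasCompactSupport.intro (IsCompact.prod f.hasCompactSupport η.hasCompactSupport) ?_
    rintro ⟨s, t⟩ hst
    by_contra hne
    simp only [Function.uncurry_apply_pair, mul_eq_zero, not_or] at hne
    exact hst ⟨subset_tsupport _ hne.1, subset_tsupport _ hne.2.2⟩
  · refine HasCompactSupport.intro (IsCompact.prod (IsCompact.inv g.hasCompactSupport)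
      η.hasCompactSupport) ?_
    rintro ⟨s, t⟩ hst
    by_contra hne
    simp only [Function.uncurry_apply_pair, mul_eq_zero, not_or] at hne
    exact hst ⟨by simpa using subset_tsupport _ hne.1, subset_tsupport _ hne.2.2⟩

theorem integral_functional_rightRegular (hp : p ≠ ∞) (g η : C_c(G, ℂ)) (u : Lp ℂ p μ) :
    ∫ s, g s⁻¹ * lpFunctional (ccLp q μ η) (rightRegular p μ s u) ∂μ
      = ∫ s, u s * ccCoefficient p q μ hp g η s ∂μ := by
  have h := (denseRange_ccLp p μ hp).equalizer
    (continuous_integral_functional_rightRegular hp g (lpFunctional (ccLp q μ η)))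
    (lpFunctional (ccLp q μ (ccCoefficient p q μ hp g η))).continuous (by
      funext f
      simp only [Function.comp_apply]
      rw [integral_functional_rightRegular_ccLp hp, lpFunctional_ccLp]
      refine integral_congr_ae ?_
      filter_upwards [coeFn_ccLp p μ f] with s hs
      rw [hs])
  rw [← lpFunctional_ccLp (p := p) (q := q)]
  exact congrFun h u

theorem integrableOn_smul_leftRegular (hp : p ≠ ∞) (u ξ : Lp ℂ p μ) {K : Set G}
    (hK : IsCompact K) : IntegrableOn (fun s => u s • leftRegular p μ s ξ) K μ :=
  (integrableOn_Lp u hK.measure_lt_top.ne).smul_bdd ‖ξ‖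
    ((continuous_leftRegular p μ hp ξ).continuousOn.aestronglyMeasurable_of_isCompact hK
      hK.measurableSet)
    (Filter.Eventually.of_forall fun s => (norm_leftRegular_apply p μ s ξ).le)

omit [Fact (1 ≤ q)] [ENNReal.HolderConjugate p q] in
/-- The convolution of `u`, vanishing off the compact set `K`, with `g` is both an average of left
translates of `g` and an average of right translates of `u`. -/
theorem setIntegral_smul_leftRegular (hp1 : 1 < p) (hp : p ≠ ∞) (g : C_c(G, ℂ)) (u : Lp ℂ p μ)
    {K : Set G} (hK : IsCompact K) (hu : ∀ᵐ x ∂μ, x ∉ K → u x = 0) :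
    ∫ s in K, u s • leftRegular p μ s (ccLp p μ g) ∂μ
      = ∫ s, g s⁻¹ • rightRegular p μ s u ∂μ := by
  -- The identity is tested against `C_c` functions viewed in `L^r`. These separate points because
  -- `r` is finite, which is where `1 < p` enters.
  let r := ENNReal.conjExponent p
  have hr : r ≠ ∞ := by
    simp only [r, ENNReal.conjExponent, ne_eq, ENNReal.add_eq_top, ENNReal.one_ne_top,
      ENNReal.inv_eq_top, false_or]
    exact (tsub_pos_of_lt hp1).ne'
  have : Fact (1 ≤ r) := ⟨by simp [r, ENNReal.conjExponent]⟩
  refine eq_of_forall_lpFunctional_ccLp (q := r) hp hr fun η => ?_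
  rw [← ContinuousLinearMap.integral_comp_comm _ (integrableOn_smul_leftRegular hp u _ hK),
    ← ContinuousLinearMap.integral_comp_comm _ (integrable_smul_rightRegular hp g u)]
  simp only [map_smul, smul_eq_mul]
  rw [integral_functional_rightRegular hp]
  refine setIntegral_eq_integral_of_ae_compl_eq_zero ?_
  filter_upwards [hu] with s hs hsK
  rw [hs hsK, zero_mul]

omit [Fact (1 ≤ q)] [ENNReal.HolderConjugate p q] in
/-- An operator that commutes with right translations commutes with convolution. -/
theorem map_setIntegral_smul_leftRegular (hp1 : 1 < p) (hp : p ≠ ∞) (g : C_c(G, ℂ))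
    (T : Lp ℂ p μ →L[ℂ] Lp ℂ p μ)
    (hT : ∀ s ξ, T (rightRegular p μ s ξ) = rightRegular p μ s (T ξ))
    (u : Lp ℂ p μ) {K L : Set G} (hK : IsCompact K) (hL : IsCompact L)
    (hu : ∀ᵐ x ∂μ, x ∉ K → u x = 0) (hTu : ∀ᵐ x ∂μ, x ∉ L → T u x = 0) :
    T (∫ s in K, u s • leftRegular p μ s (ccLp p μ g) ∂μ)
      = ∫ s in L, T u s • leftRegular p μ s (ccLp p μ g) ∂μ := by
  rw [setIntegral_smul_leftRegular hp1 hp g u hK hu,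
    setIntegral_smul_leftRegular hp1 hp g (T u) hL hTu,
    ← ContinuousLinearMap.integral_comp_comm _ (integrable_smul_rightRegular hp g u)]
  simp only [map_smul, hT]

end Convolution

/-! ### Essential supports -/

section EssentialSupport

variable {G : Type*} [Group G] [TopologicalSpace G] [IsTopologicalGroup G]
  [LocallyCompactSpace G] [MeasurableSpace G] [BorelSpace G]
  {p : ℝ≥0∞} [Fact (1 ≤ p)] {μ : Measure G} [IsLeftHaar μ]

/-- The essential support of `u ∈ L^p(G)`: the points near which `u` does not vanish almost
everywhere. -/
def essSupport (u : Lp ℂ p μ) : Set G :=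
  {x | ∀ U ∈ 𝓝 x, ¬ ∀ᵐ t ∂μ, t ∈ U → u t = 0}

theorem isClosed_essSupport (u : Lp ℂ p μ) : IsClosed (essSupport u) := by
  rw [← isOpen_compl_iff, isOpen_iff_mem_nhds]
  intro x hx
  simp only [essSupport, Set.mem_compl_iff, Set.mem_ofPred_eq, not_forall, not_not] at hx
  obtain ⟨U, hU, h⟩ := hx
  filter_upwards [eventually_mem_nhds_iff.2 hU] with y hy hy'
  exact hy' U hy h

/-- The measure may fail to be σ-finite, but each set `‖u‖ ≥ 1 / (n + 1)` has finite measure, so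
inner regularity applies to it; countably many such sets exhaust the points where `u` is nonzero. -/
theorem exists_isCompact_subset_of_not_ae_zero (hp : p ≠ ∞) (u : Lp ℂ p μ) {B : Set G}
    (hB : MeasurableSet B) (h : ¬ ∀ᵐ t ∂μ, t ∈ B → u t = 0) :
    ∃ K ⊆ B, IsCompact K ∧ 0 < μ K ∧ ∀ t ∈ K, u t ≠ 0 := by
  have h0 : p ≠ 0 := (zero_lt_one.trans_le (Fact.out : 1 ≤ p)).ne'
  by_contra! hc
  refine h ?_
  have hn : ∀ n : ℕ, ∀ᵐ t ∂μ, ¬ (t ∈ B ∧ (n + 1 : ℝ≥0)⁻¹ ≤ ‖u t‖₊) := by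
    intro n
    have hpos : (n + 1 : ℝ≥0)⁻¹ ≠ 0 := by positivity
    have hm : MeasurableSet (B ∩ {t | (n + 1 : ℝ≥0)⁻¹ ≤ ‖u t‖₊}) :=
      hB.inter (measurableSet_le measurable_const (Lp.stronglyMeasurable u).measurable.nnnorm)
    have hfin : μ (B ∩ {t | (n + 1 : ℝ≥0)⁻¹ ≤ ‖u t‖₊}) ≠ ∞ :=
      ((measure_mono Set.inter_subset_right).trans_lt
        ((Lp.memLp u).meas_ge_lt_top h0 hp hpos)).ne
    rw [ae_iff]
    simp only [not_not]
    change μ (B ∩ {t | (n + 1 : ℝ≥0)⁻¹ ≤ ‖u t‖₊}) = 0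
    by_contra hne
    obtain ⟨K, hKs, hK, hK0⟩ := hm.exists_lt_isCompact_of_ne_top hfin (pos_iff_ne_zero.2 hne)
    obtain ⟨t, htK, ht⟩ := hc K (hKs.trans Set.inter_subset_left) hK hK0
    have h1 := (hKs htK).2
    simp only [Set.mem_ofPred_eq, ht, nnnorm_zero, nonpos_iff_eq_zero] at h1
    exact hpos h1
  filter_upwards [ae_all_iff.2 hn] with t ht htB
  by_contra hne
  obtain ⟨n, hn⟩ := exists_nat_one_div_lt (norm_pos_iff.2 hne)
  refine ht n ⟨htB, ?_⟩
  rw [← NNReal.coe_le_coe]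
  push_cast
  rw [← one_div]
  exact hn.le

theorem ae_eq_zero_of_disjoint_essSupport (u : Lp ℂ p μ) {K : Set G} (hK : IsCompact K)
    (h : Disjoint K (essSupport u)) : ∀ᵐ t ∂μ, t ∈ K → u t = 0 := by
  refine hK.induction_on (p := fun K => ∀ᵐ t ∂μ, t ∈ K → u t = 0) (by simp) ?_ ?_ ?_
  · intro s t hst ht
    filter_upwards [ht] with x hx hxs using hx (hst hxs)
  · intro s t hs ht
    filter_upwards [hs, ht] with x h1 h2 hx using hx.elim h1 h2
  · intro x hx
    have := Set.disjoint_left.1 h hx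
    simp only [essSupport, Set.mem_ofPred_eq, not_forall, not_not] at this
    obtain ⟨U, hU, h⟩ := this
    exact ⟨U, mem_nhdsWithin_of_mem_nhds hU, h⟩

/-- An element of `L^p(G)` vanishes almost everywhere off its essential support. -/
theorem ae_eq_zero_of_essSupport_subset (hp : p ≠ ∞) (u : Lp ℂ p μ) {C : Set G}
    (hC : MeasurableSet C) (h : essSupport u ⊆ C) : ∀ᵐ t ∂μ, t ∉ C → u t = 0 := by
  by_contra hne
  obtain ⟨K, hKC, hK, hK0, hKu⟩ :=
    exists_isCompact_subset_of_not_ae_zero hp u hC.compl (by simpa using hne)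
  have h1 := ae_eq_zero_of_disjoint_essSupport u hK
    (Set.disjoint_left.2 fun t ht hts => hKC ht (h hts))
  refine hK0.ne' (measure_mono_null (fun t ht => ?_) (ae_iff.1 h1))
  simp only [Set.mem_ofPred_eq, Classical.not_imp]
  exact ⟨ht, hKu t ht⟩

theorem essSupport_nonempty (hp : p ≠ ∞) {u : Lp ℂ p μ} (hu : u ≠ 0) : (essSupport u).Nonempty := by
  by_contra hne
  rw [Set.not_nonempty_iff_eq_empty] at hne
  refine hu (Lp.ext ?_)
  filter_upwards [ae_eq_zero_of_essSupport_subset hp u MeasurableSet.empty hne.subset,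
    Lp.coeFn_zero ℂ p μ] with t h1 h2
  rw [h1 (by simp), h2, Pi.zero_apply]

theorem essSupport_zero : essSupport (0 : Lp ℂ p μ) = ∅ := by
  refine Set.eq_empty_of_forall_notMem fun x hx => hx Set.univ Filter.univ_mem ?_
  filter_upwards [Lp.coeFn_zero ℂ p μ] with t ht _
  rw [ht, Pi.zero_apply]

theorem essSupport_subset_union {u v w : Lp ℂ p μ}
    (h : ∀ᵐ t ∂μ, v t = 0 → w t = 0 → u t = 0) : essSupport u ⊆ essSupport v ∪ essSupport w := by
  intro x hx
  by_contra hne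
  simp only [Set.mem_union, not_or, essSupport, Set.mem_ofPred_eq, not_forall, not_not] at hne
  obtain ⟨⟨U, hU, h1⟩, ⟨W, hW, h2⟩⟩ := hne
  refine hx (U ∩ W) (Filter.inter_mem hU hW) ?_
  filter_upwards [h, h1, h2] with t h3 h4 h5 ht using h3 (h4 ht.1) (h5 ht.2)

theorem essSupport_mono {u v : Lp ℂ p μ} (h : ∀ᵐ t ∂μ, v t = 0 → u t = 0) :
    essSupport u ⊆ essSupport v := by
  have := essSupport_subset_union (u := u) (v := v) (w := v) (by
    filter_upwards [h] with t ht h1 _ using ht h1)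
  rwa [Set.union_self] at this

theorem mul_mem_essSupport {u : Lp ℂ p μ} {x s : G}
    (hx : x ∈ essSupport (rightRegular p μ s u)) : x * s ∈ essSupport u := by
  intro U hU h
  refine hx ((· * s) ⁻¹' U) ((continuous_mul_const s).continuousAt.preimage_mem_nhds hU) ?_
  filter_upwards [coeFn_rightRegular p μ s u, (quasiMeasurePreserving_mul_right' μ s).ae h]
    with t h1 h2 ht
  rw [h1]
  exact h2 ht

end EssentialSupport

/-! ### Separating essential supports by right translates -/

section Intersections

variable {G : Type*} [Group G] [TopologicalSpace G] [IsTopologicalGroup G]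
  [LocallyCompactSpace G] [T2Space G] [MeasurableSpace G] [BorelSpace G]
  {p : ℝ≥0∞} [Fact (1 ≤ p)] {μ : Measure G} [IsLeftHaar μ]

/-- The indicator of a set of finite measure, as an element of `L^p`. -/
noncomputable abbrev oneLp (p : ℝ≥0∞) {μ : Measure G} {A : Set G} (hA : MeasurableSet A)
    (hμA : μ A ≠ ∞) : Lp ℂ p μ :=
  indicatorConstLp p hA hμA (1 : ℂ)

theorem coeFn_oneLp {A : Set G} (hA : MeasurableSet A) (hμA : μ A ≠ ∞) :
    ∀ᵐ t ∂μ, oneLp p hA hμA t = A.indicator (fun _ => 1) t :=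
  indicatorConstLp_coeFn

/-- Two compact sets of positive measure have translates that meet in positive measure. -/
theorem exists_measure_inter_mul_right_pos (hp1 : 1 < p) (hp : p ≠ ∞) {A B : Set G}
    (hA : IsCompact A) (hB : IsCompact B) (hA0 : 0 < μ A) (hB0 : 0 < μ B) :
    ∃ s, 0 < μ (A ∩ {t | t * s ∈ B}) := by
  by_contra! hc
  -- Take `g = 1` on `B⁻¹ * A` and pair the two forms of `1_B * g` with `1_A`. The average of left
  -- translates gives `μ(B) μ(A)`, while the average of right translates gives `0` if all the
  -- intersections are null.
  obtain ⟨g₀, hg₀, -, hg₀c, -⟩ := exists_continuous_one_zero_of_isCompact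
    (hB.inv.mul hA) isClosed_empty (Set.disjoint_empty _)
  let g : C_c(G, ℂ) := ⟨⟨fun x => (g₀ x : ℂ), by fun_prop⟩, hg₀c.mono (fun x hx => by
    simp only [Function.mem_support] at hx ⊢
    contrapose! hx; simp [hx])⟩
  have hg : ∀ s ∈ B, ∀ t ∈ A, g (s⁻¹ * t) = 1 := fun s hs t ht => by
    change (g₀ (s⁻¹ * t) : ℂ) = 1
    rw [hg₀ ⟨s⁻¹, Set.inv_mem_inv.2 hs, t, ht, rfl⟩]; simp
  let r := ENNReal.conjExponent p
  have : Fact (1 ≤ r) := ⟨by simp [r, ENNReal.conjExponent]⟩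
  let u : Lp ℂ p μ := oneLp p hB.measurableSet hB.measure_lt_top.ne
  let φ : StrongDual ℂ (Lp ℂ p μ) :=
    lpFunctional (oneLp r hA.measurableSet hA.measure_lt_top.ne)
  have hu := coeFn_oneLp (p := p) hB.measurableSet hB.measure_lt_top.ne (μ := μ)
  have key := congrArg φ (setIntegral_smul_leftRegular hp1 hp g u hB (by
    filter_upwards [hu] with x hx hxB
    rw [hx, Set.indicator_of_notMem hxB]))
  rw [← ContinuousLinearMap.integral_comp_comm _ (integrableOn_smul_leftRegular hp u _ hB),
    ← ContinuousLinearMap.integral_comp_comm _ (integrable_smul_rightRegular hp g u)] at key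
  simp only [map_smul, smul_eq_mul] at key
  have h1 : ∀ s, φ (rightRegular p μ s u) = 0 := by
    intro s
    rw [lpFunctional_indicatorConstLp, integral_eq_zero_of_ae]
    rw [Filter.EventuallyEq, ae_restrict_iff' hA.measurableSet]
    have h2 : ∀ᵐ t ∂μ, t ∉ A ∩ {t | t * s ∈ B} :=
      measure_eq_zero_iff_ae_notMem.1 (nonpos_iff_eq_zero.1 (hc s))
    filter_upwards [h2, coeFn_rightRegular p μ s u,
      (quasiMeasurePreserving_mul_right' μ s).ae hu] with t h3 h4 h5 htA
    rw [h4, h5, Set.indicator_of_notMem (show t * s ∉ B from fun h => h3 ⟨htA, h⟩), Pi.zero_apply]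
  have h2 : ∀ s ∈ B, φ (leftRegular p μ s (ccLp p μ g)) = (μ A).toReal := by
    intro s hs
    rw [lpFunctional_indicatorConstLp, setIntegral_congr_ae (g := fun _ => (1 : ℂ))
      hA.measurableSet]
    · simp [Measure.real]
    · filter_upwards [coeFn_leftRegular p μ s (ccLp p μ g),
        (measurePreserving_mul_left μ s⁻¹).quasiMeasurePreserving.ae_eq_comp (coeFn_ccLp p μ g)]
        with t h3 h4 ht
      simp only [Function.comp_apply] at h4
      rw [h3, h4, hg s hs t ht]
  simp only [h1, mul_zero, integral_zero] at key
  rw [setIntegral_congr_ae (g := fun _ => ((μ A).toReal : ℂ)) hB.measurableSet] at key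
  · simp only [integral_const, MeasurableSet.univ, measureReal_restrict_apply, Set.univ_inter,
      Complex.real_smul, mul_eq_zero, Complex.ofReal_eq_zero] at key
    rcases key with h | h
    · exact (ENNReal.toReal_pos hB0.ne' hB.measure_lt_top.ne).ne' h
    · exact (ENNReal.toReal_pos hA0.ne' hA.measure_lt_top.ne).ne' h
  · filter_upwards [hu] with s hs hsB
    rw [h2 s hsB, hs, Set.indicator_of_mem hsB, one_mul]

/-- Otherwise neighbourhoods `U` of `x` and `W` of `y` satisfy `U⁻¹ * W ⊆ O`. Compact sets `A ⊆ U`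
and `B ⊆ W` on which `u` and `v` do not vanish have translates meeting in positive measure, and the
translating element is forced into `O`, against disjointness. -/
theorem inv_mul_notMem_of_mem_essSupport (hp1 : 1 < p) (hp : p ≠ ∞) {u v : Lp ℂ p μ} {O : Set G}
    (hO : IsOpen O) (h : ∀ s ∈ O, ∀ᵐ t ∂μ, u t = 0 ∨ rightRegular p μ s v t = 0)
    {x y : G} (hx : x ∈ essSupport u) (hy : y ∈ essSupport v) : x⁻¹ * y ∉ O := by
  intro hxy
  have hc : Continuous fun q : G × G => q.1⁻¹ * q.2 := by fun_prop
  obtain ⟨U, W, hU, hxU, hW, hyW, hUW⟩ :=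
    mem_nhds_prod_iff'.1 (hc.continuousAt.preimage_mem_nhds (x := (x, y)) (hO.mem_nhds hxy))
  obtain ⟨A, hAU, hA, hA0, hAu⟩ := exists_isCompact_subset_of_not_ae_zero hp u hU.measurableSet
    (hx U (hU.mem_nhds hxU))
  obtain ⟨B, hBW, hB, hB0, hBv⟩ := exists_isCompact_subset_of_not_ae_zero hp v hW.measurableSet
    (hy W (hW.mem_nhds hyW))
  obtain ⟨s, hs⟩ := exists_measure_inter_mul_right_pos hp1 hp hA hB hA0 hB0
  obtain ⟨t, htA, htB⟩ := nonempty_of_measure_ne_zero hs.ne'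
  have hsO : s ∈ O := by
    have := hUW (show (t, t * s) ∈ U ×ˢ W from ⟨hAU htA, hBW htB⟩)
    simpa using this
  have h1 : ∀ᵐ t ∂μ, t ∉ A ∩ {t | t * s ∈ B} := by
    filter_upwards [h s hsO, coeFn_rightRegular p μ s v] with t h2 h3 ht
    rw [h3] at h2
    exact h2.elim (hAu t ht.1) (hBv _ ht.2)
  exact hs.ne' (measure_eq_zero_iff_ae_notMem.2 h1)

end Intersections

/-! ### Isometric convolvers are multiples of left translations -/

section IsometricConvolvers

variable {G : Type*} [Group G] [TopologicalSpace G] [IsTopologicalGroup G]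
  [LocallyCompactSpace G] [T2Space G] [MeasurableSpace G] [BorelSpace G]
  {p : ℝ≥0∞} [Fact (1 ≤ p)] {μ : Measure G} [IsLeftHaar μ]
  {T : Lp ℂ p μ →L[ℂ] Lp ℂ p μ}

/-- `T g` is the sum of the disjoint functions `T f` and `T (g - f)`, so no cancellation can occur
between them. -/
theorem ae_eq_zero_of_isometry (hp : p ≠ ∞) (hp2 : p ≠ 2) (hTn : ∀ ξ, ‖T ξ‖ = ‖ξ‖)
    {f g : Lp ℂ p μ} (h : ∀ᵐ t ∂μ, f t = 0 ∨ (g - f) t = 0) :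
    ∀ᵐ t ∂μ, T g t = 0 → T f t = 0 := by
  filter_upwards [ae_disjoint_of_isometry hp hp2 T hTn h, Lp.coeFn_sub (T g) (T f)] with t h1 h2 h3
  rw [map_sub, h2] at h1
  simpa [h3] using h1

theorem essSupport_map_oneLp_mono (hp : p ≠ ∞) (hp2 : p ≠ 2) (hTn : ∀ ξ, ‖T ξ‖ = ‖ξ‖)
    {A B : Set G} (hA : MeasurableSet A) (hB : MeasurableSet B) (hμA : μ A ≠ ∞) (hμB : μ B ≠ ∞)
    (hAB : A ⊆ B) : essSupport (T (oneLp p hA hμA)) ⊆ essSupport (T (oneLp p hB hμB)) := by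
  refine essSupport_mono (ae_eq_zero_of_isometry hp hp2 hTn ?_)
  filter_upwards [Lp.coeFn_sub (oneLp p hB hμB) (oneLp p hA hμA), coeFn_oneLp (p := p) hA hμA,
    coeFn_oneLp (p := p) hB hμB] with t h1 h2 h3
  rw [h1, Pi.sub_apply, h2, h3]
  by_cases ht : t ∈ A
  · simp [ht, hAB ht]
  · simp [ht]

theorem essSupport_map_oneLp_union (hp : p ≠ ∞) (hp2 : p ≠ 2) (hTn : ∀ ξ, ‖T ξ‖ = ‖ξ‖)
    {A B : Set G} (hA : MeasurableSet A) (hB : MeasurableSet B) (hμA : μ A ≠ ∞) (hμB : μ B ≠ ∞)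
    (hμAB : μ (A ∪ B) ≠ ∞) :
    essSupport (T (oneLp p (hA.union hB) hμAB))
      ⊆ essSupport (T (oneLp p hA hμA)) ∪ essSupport (T (oneLp p hB hμB)) := by
  refine essSupport_subset_union ?_
  set d : Lp ℂ p μ := oneLp p (hA.union hB) hμAB - oneLp p hA hμA with hd
  have h1 : ∀ᵐ t ∂μ, T (oneLp p hB hμB) t = 0 → T d t = 0 := by
    refine ae_eq_zero_of_isometry hp hp2 hTn ?_
    filter_upwards [Lp.coeFn_sub (oneLp p (hA.union hB) hμAB) (oneLp p hA hμA),
      Lp.coeFn_sub (oneLp p hB hμB) d, coeFn_oneLp (p := p) hA hμA, coeFn_oneLp (p := p) hB hμB,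
      coeFn_oneLp (p := p) (hA.union hB) hμAB] with t h1 h2 h3 h4 h5
    rw [h2, Pi.sub_apply, hd, h1, Pi.sub_apply, h3, h4, h5]
    by_cases htA : t ∈ A
    · simp [htA]
    · by_cases htB : t ∈ B <;> simp [htA, htB]
  have h2 : T (oneLp p (hA.union hB) hμAB) = T (oneLp p hA hμA) + T d := by
    rw [← map_add, hd, add_sub_cancel]
  filter_upwards [h1, Lp.coeFn_add (T (oneLp p hA hμA)) (T d)] with t h3 h4 h5 h6
  rw [h2, h4, Pi.add_apply, h5, h3 h6, add_zero]

/-- For `s ∉ V⁻¹ * V` the sets `V` and `V * s⁻¹` are disjoint; `T` transports this to `T 1_V` and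
its right translate, and `inv_mul_notMem_of_mem_essSupport` applies on the open complement of `V⁻¹ *
V`. -/
theorem inv_mul_mem_of_mem_essSupport_map (hp1 : 1 < p) (hp : p ≠ ∞) (hp2 : p ≠ 2)
    (hTn : ∀ ξ, ‖T ξ‖ = ‖ξ‖) (hT : ∀ s ξ, T (rightRegular p μ s ξ) = rightRegular p μ s (T ξ))
    {V : Set G} (hV : IsCompact V) {x y : G}
    (hx : x ∈ essSupport (T (oneLp p hV.measurableSet hV.measure_lt_top.ne)))
    (hy : y ∈ essSupport (T (oneLp p hV.measurableSet hV.measure_lt_top.ne))) :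
    x⁻¹ * y ∈ V⁻¹ * V := by
  by_contra hne
  refine inv_mul_notMem_of_mem_essSupport hp1 hp (hV.inv.mul hV).isClosed.isOpen_compl
    (fun s hs => ?_) hx hy hne
  rw [← hT]
  refine ae_disjoint_of_isometry hp hp2 T hTn ?_
  have h1 := coeFn_oneLp (p := p) hV.measurableSet hV.measure_lt_top.ne (μ := μ)
  filter_upwards [h1, coeFn_rightRegular p μ s (oneLp p hV.measurableSet hV.measure_lt_top.ne),
    (quasiMeasurePreserving_mul_right' μ s).ae h1] with t h2 h3 h4
  rw [h3, h2, h4]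
  by_cases ht : t ∈ V
  · right
    refine Set.indicator_of_notMem (fun hts => hs ⟨t⁻¹, Set.inv_mem_inv.2 ht, t * s, hts, ?_⟩) _
    simp
  · left
    exact Set.indicator_of_notMem ht _

theorem oneLp_ne_zero {V : Set G} (hp : p ≠ ∞) (hV : MeasurableSet V) (hμV : μ V ≠ ∞)
    (h : μ V ≠ 0) : oneLp p hV hμV ≠ 0 := by
  have h0 : p ≠ 0 := (zero_lt_one.trans_le (Fact.out : 1 ≤ p)).ne'
  rw [← norm_pos_iff, norm_indicatorConstLp h0 hp, norm_one, one_mul]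
  exact Real.rpow_pos_of_pos (ENNReal.toReal_pos h hμV) _

/-- The essential supports of the images of the indicators of compact neighbourhoods of the unit
have a common point. -/
theorem exists_forall_mem_essSupport_map (hp1 : 1 < p) (hp : p ≠ ∞) (hp2 : p ≠ 2)
    (hTn : ∀ ξ, ‖T ξ‖ = ‖ξ‖) (hT : ∀ s ξ, T (rightRegular p μ s ξ) = rightRegular p μ s (T ξ)) :
    ∃ x₀ : G, ∀ (V : Set G) (hV : IsCompact V), V ∈ 𝓝 (1 : G) →
      x₀ ∈ essSupport (T (oneLp p hV.measurableSet hV.measure_lt_top.ne)) := by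
  let ι := {V : Set G // IsCompact V ∧ V ∈ 𝓝 (1 : G)}
  let X : ι → Set G := fun V =>
    essSupport (T (oneLp p V.2.1.measurableSet V.2.1.measure_lt_top.ne))
  have hι : Nonempty ι := by
    obtain ⟨V, hV, hV1⟩ := exists_compact_mem_nhds (1 : G)
    exact ⟨⟨V, hV, hV1⟩⟩
  have hne : ∀ V, (X V).Nonempty := fun V => by
    refine essSupport_nonempty hp (norm_pos_iff.1 ?_)
    rw [hTn, norm_pos_iff]
    exact oneLp_ne_zero hp _ _ (Measure.measure_pos_of_mem_nhds μ V.2.2).ne'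
  have hcomp : ∀ V, IsCompact (X V) := fun V => by
    obtain ⟨x, hx⟩ := hne V
    refine IsCompact.of_isClosed_subset ((V.2.1.inv.mul V.2.1).smul x) (isClosed_essSupport _)
      fun y hy => ?_
    exact ⟨_, inv_mul_mem_of_mem_essSupport_map hp1 hp hp2 hTn hT V.2.1 hx hy, by simp⟩
  -- The supports shrink with `V`, so intersecting neighbourhoods makes the family directed, and
  -- Cantor's intersection theorem gives the common point.
  have hdir : Directed (· ⊇ ·) X := fun V W => by
    refine ⟨⟨V.1 ∩ W.1, V.2.1.inter W.2.1, Filter.inter_mem V.2.2 W.2.2⟩, ?_, ?_⟩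
    · exact essSupport_map_oneLp_mono hp hp2 hTn _ _ _ _ Set.inter_subset_left
    · exact essSupport_map_oneLp_mono hp hp2 hTn _ _ _ _ Set.inter_subset_right
  obtain ⟨x, hx⟩ := IsCompact.nonempty_iInter_of_directed_nonempty_isCompact_isClosed X hdir hne
    hcomp (fun V => isClosed_essSupport _)
  exact ⟨x, fun V hV h1 => Set.mem_iInter.1 hx ⟨V, hV, h1⟩⟩

/-- Cover `V` by finitely many right translates `W * v` with `v ∈ V`. The image of the indicator of
`W * v` is a right translate of `T 1_W`, whose support lies in `x₀ • (W⁻¹ * W)` because it contains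
`x₀`. -/
theorem essSupport_map_oneLp_subset (hp1 : 1 < p) (hp : p ≠ ∞) (hp2 : p ≠ 2)
    (hTn : ∀ ξ, ‖T ξ‖ = ‖ξ‖) (hT : ∀ s ξ, T (rightRegular p μ s ξ) = rightRegular p μ s (T ξ))
    {x₀ : G} (hx₀ : ∀ (V : Set G) (hV : IsCompact V), V ∈ 𝓝 (1 : G) →
      x₀ ∈ essSupport (T (oneLp p hV.measurableSet hV.measure_lt_top.ne)))
    {V : Set G} (hV : IsCompact V) {W : Set G} (hW : IsCompact W) (hW1 : W ∈ 𝓝 (1 : G)) :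
    essSupport (T (oneLp p hV.measurableSet hV.measure_lt_top.ne)) ⊆ x₀ • (W⁻¹ * W * V) := by
  set C : Set G := x₀ • (W⁻¹ * W * V)
  -- Compact induction ranges over arbitrary subsets of `V`, so the property is phrased through a
  -- measurable set of finite measure containing them.
  suffices H : ∃ E, V ⊆ E ∧ ∃ (hE : MeasurableSet E) (hμE : μ E ≠ ∞),
      essSupport (T (oneLp p hE hμE)) ⊆ C by
    obtain ⟨E, hVE, hE, hμE, h⟩ := H
    exact (essSupport_map_oneLp_mono hp hp2 hTn _ hE _ hμE hVE).trans h
  refine hV.induction_on (p := fun S => ∃ E, S ⊆ E ∧ ∃ (hE : MeasurableSet E) (hμE : μ E ≠ ∞),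
      essSupport (T (oneLp p hE hμE)) ⊆ C) ?_ ?_ ?_ ?_
  · refine ⟨∅, subset_rfl, MeasurableSet.empty, by simp, ?_⟩
    have : (oneLp p MeasurableSet.empty (by simp) : Lp ℂ p μ) = 0 := indicatorConstLp_empty
    rw [this, map_zero, essSupport_zero]
    exact Set.empty_subset _
  · rintro S S' hS ⟨E, hE, h⟩
    exact ⟨E, hS.trans hE, h⟩
  · rintro S S' ⟨E, hSE, hE, hμE, h⟩ ⟨E', hSE', hE', hμE', h'⟩
    have hfin : μ (E ∪ E') ≠ ∞ := measure_union_ne_top hμE hμE'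
    exact ⟨E ∪ E', Set.union_subset_union hSE hSE', hE.union hE', hfin,
      (essSupport_map_oneLp_union hp hp2 hTn hE hE' hμE hμE' hfin).trans (Set.union_subset h h')⟩
  · intro v hv
    have hm : MeasurableSet ((· * v⁻¹) ⁻¹' W) := measurable_mul_const v⁻¹ hW.measurableSet
    have hc : IsCompact ((· * v⁻¹) ⁻¹' W) := (Homeomorph.mulRight v⁻¹).isCompact_preimage.2 hW
    refine ⟨(· * v⁻¹) ⁻¹' W, mem_nhdsWithin_of_mem_nhds
      ((continuous_mul_const v⁻¹).continuousAt.preimage_mem_nhds (by simpa using hW1)),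
      _, subset_rfl, hm, hc.measure_lt_top.ne, fun y hy => ?_⟩
    have h1 : oneLp p hm hc.measure_lt_top.ne
        = rightRegular p μ v⁻¹ (oneLp p hW.measurableSet hW.measure_lt_top.ne) := by
      refine Lp.ext ?_
      filter_upwards [coeFn_oneLp (p := p) hm hc.measure_lt_top.ne,
        coeFn_rightRegular p μ v⁻¹ (oneLp p hW.measurableSet hW.measure_lt_top.ne),
        (quasiMeasurePreserving_mul_right' μ v⁻¹).ae
          (coeFn_oneLp (p := p) hW.measurableSet hW.measure_lt_top.ne)] with t h2 h3 h4
      rw [h2, h3, h4]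
      rfl
    rw [h1, hT] at hy
    have h2 := inv_mul_mem_of_mem_essSupport_map hp1 hp hp2 hTn hT hW (hx₀ W hW hW1)
      (mul_mem_essSupport hy)
    exact ⟨_, ⟨_, h2, v, hv, rfl⟩, by simp [mul_assoc]⟩

/-- Let `W` shrink in `essSupport_map_oneLp_subset`: since `V` is closed, a point outside `x₀ • V`
is also outside `x₀ • (W⁻¹ * W * V)` for small `W`. -/
theorem ae_map_oneLp_eq_zero (hp1 : 1 < p) (hp : p ≠ ∞) (hp2 : p ≠ 2)
    (hTn : ∀ ξ, ‖T ξ‖ = ‖ξ‖) (hT : ∀ s ξ, T (rightRegular p μ s ξ) = rightRegular p μ s (T ξ))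
    {x₀ : G} (hx₀ : ∀ (V : Set G) (hV : IsCompact V), V ∈ 𝓝 (1 : G) →
      x₀ ∈ essSupport (T (oneLp p hV.measurableSet hV.measure_lt_top.ne)))
    {V : Set G} (hV : IsCompact V) :
    ∀ᵐ t ∂μ, t ∉ x₀ • V → T (oneLp p hV.measurableSet hV.measure_lt_top.ne) t = 0 := by
  refine ae_eq_zero_of_essSupport_subset hp _ (hV.smul x₀).measurableSet fun y hy => ?_
  by_contra hne
  have hz : x₀⁻¹ * y ∈ Vᶜ := fun h => hne ⟨_, h, by simp⟩
  have hc : Continuous fun q : G × G => q.1⁻¹ * q.2 * (x₀⁻¹ * y) := by fun_prop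
  have hmem : {q : G × G | q.1⁻¹ * q.2 * (x₀⁻¹ * y) ∈ Vᶜ} ∈ 𝓝 ((1, 1) : G × G) :=
    hc.continuousAt.preimage_mem_nhds (hV.isClosed.isOpen_compl.mem_nhds (by simpa using hz))
  rw [nhds_prod_eq, Filter.mem_prod_self_iff] at hmem
  obtain ⟨U, hU, hUV⟩ := hmem
  obtain ⟨W, hW1, hWU, hW⟩ := local_compact_nhds hU
  obtain ⟨_, ⟨_, ⟨a, ha, b, hb, rfl⟩, v, hv, rfl⟩, hy'⟩ :=
    essSupport_map_oneLp_subset hp1 hp hp2 hTn hT hx₀ hV hW hW1 hy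
  -- Here `x₀⁻¹ * y = a * b * v` with `a⁻¹, b ∈ W`, so `b⁻¹ * a⁻¹` carries it back to `v ∈ V`,
  -- contradicting the choice of `U`.
  have h1 := hUV (show (b, a⁻¹) ∈ U ×ˢ U from ⟨hWU hb, hWU ha⟩)
  simp only [smul_eq_mul] at hy'
  refine h1 ?_
  rw [← hy']
  simpa [mul_assoc] using hv

end IsometricConvolvers

/-! ### From localized supports to a scalar multiple of a left translation -/

section Rigidity

variable {G : Type*} [Group G] [TopologicalSpace G] [IsTopologicalGroup G]
  [LocallyCompactSpace G] [T2Space G] [MeasurableSpace G] [BorelSpace G]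
  {p : ℝ≥0∞} [Fact (1 ≤ p)] {μ : Measure G} [IsLeftHaar μ]
  {T : Lp ℂ p μ →L[ℂ] Lp ℂ p μ}

/-- An average of translates of `ξ` that are close to `ζ` is close to a multiple of `ζ`. -/
theorem norm_setIntegral_smul_leftRegular_sub_le (hp : p ≠ ∞) (u ξ ζ : Lp ℂ p μ) {K : Set G}
    (hK : IsCompact K) {ε : ℝ} (h : ∀ s ∈ K, ‖leftRegular p μ s ξ - ζ‖ ≤ ε) :
    ‖∫ s in K, u s • leftRegular p μ s ξ ∂μ - (∫ s in K, u s ∂μ) • ζ‖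
      ≤ ε * ∫ s in K, ‖u s‖ ∂μ := by
  have hu : IntegrableOn u K μ := integrableOn_Lp u hK.measure_lt_top.ne
  rw [← integral_smul_const, ← integral_sub (integrableOn_smul_leftRegular hp u ξ hK)
    (hu.smul_const ζ), ← integral_const_mul]
  refine norm_integral_le_of_norm_le (hu.norm.const_mul ε) ?_
  rw [ae_restrict_iff' hK.measurableSet]
  refine Filter.Eventually.of_forall fun s hs => ?_
  rw [← smul_sub, norm_smul, mul_comm]
  gcongr
  exact h s hs

/-- Hölder's inequality on `K`, with the exponent needed to cancel `‖1_V‖ = μ(V) ^ (1 / p)`. -/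
theorem setIntegral_norm_le {K : Set G} (hK : IsCompact K) (hp : p ≠ ∞) (u : Lp ℂ p μ) :
    ∫ s in K, ‖u s‖ ∂μ ≤ ‖u‖ * μ.real K ^ (1 - 1 / p.toReal) := by
  have h1 := eLpNorm_le_eLpNorm_mul_rpow_measure_univ (μ := μ.restrict K) (f := u)
    (Fact.out : 1 ≤ p) (Lp.aestronglyMeasurable u).restrict
  have hpr : 1 ≤ p.toReal := by
    rw [← ENNReal.toReal_one]; exact ENNReal.toReal_mono hp Fact.out
  have he : 0 ≤ 1 - 1 / p.toReal := by
    rw [sub_nonneg, div_le_one (by linarith)]; exact hpr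
  rw [Measure.restrict_apply_univ, ENNReal.toReal_one, div_one] at h1
  have h2 := h1.trans (mul_le_mul_left (eLpNorm_mono_measure u Measure.restrict_le_self) _)
  rw [integral_norm_eq_lintegral_enorm (Lp.aestronglyMeasurable u).restrict,
    ← eLpNorm_one_eq_lintegral_enorm, Lp.norm_def, Measure.real, ENNReal.toReal_rpow,
    ← ENNReal.toReal_mul]
  exact ENNReal.toReal_mono (ENNReal.mul_ne_top (Lp.memLp u).2.ne
    (ENNReal.rpow_ne_top_of_nonneg he hK.measure_lt_top.ne)) h2

/-- The scalar `c` is the integral of `T 1_V` over `x₀ • V` divided by `μ(V)`; it depends on `V` but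
not on `g`. Both `1_V * g` and its image are averages of nearly constant families, and each
contributes an error `ε`. -/
theorem exists_norm_map_ccLp_sub_le (hp1 : 1 < p) (hp : p ≠ ∞) (hp2 : p ≠ 2)
    (hTn : ∀ ξ, ‖T ξ‖ = ‖ξ‖) (hT : ∀ s ξ, T (rightRegular p μ s ξ) = rightRegular p μ s (T ξ))
    {x₀ : G} (hx₀ : ∀ (V : Set G) (hV : IsCompact V), V ∈ 𝓝 (1 : G) →
      x₀ ∈ essSupport (T (oneLp p hV.measurableSet hV.measure_lt_top.ne)))
    {V : Set G} (hV : IsCompact V) (hV1 : V ∈ 𝓝 (1 : G)) :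
    ∃ c : ℂ, ‖c‖ ≤ 1 ∧ ∀ (g : C_c(G, ℂ)) (ε : ℝ),
      (∀ s ∈ V, ‖leftRegular p μ s (ccLp p μ g) - ccLp p μ g‖ ≤ ε) →
      ‖T (ccLp p μ g) - c • leftRegular p μ x₀ (ccLp p μ g)‖ ≤ 2 * ε := by
  have h0 : p ≠ 0 := (zero_lt_one.trans_le (Fact.out : 1 ≤ p)).ne'
  have hμV : 0 < μ V := Measure.measure_pos_of_mem_nhds μ hV1
  have hm : 0 < μ.real V := ENNReal.toReal_pos hμV.ne' hV.measure_lt_top.ne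
  set m := μ.real V with hmdef
  set u : Lp ℂ p μ := oneLp p hV.measurableSet hV.measure_lt_top.ne with hu
  have hone := coeFn_oneLp (p := p) hV.measurableSet hV.measure_lt_top.ne (μ := μ)
  have hK : IsCompact (x₀ • V) := hV.smul x₀
  have hbound : ∫ s in x₀ • V, ‖T u s‖ ∂μ ≤ m := by
    refine (setIntegral_norm_le hK hp (T u)).trans ?_
    have hsm : μ.real (x₀ • V) = m := by rw [Measure.real, measure_smul, hmdef, Measure.real]
    -- The powers `1 / p` and `1 - 1 / p` of `μ(V) = μ(x₀ • V)` multiply to `m`.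
    rw [hTn, hu, norm_indicatorConstLp h0 hp, norm_one, one_mul, hsm, ← hmdef, ← Real.rpow_add hm, add_sub_cancel, Real.rpow_one]
  have hnorm : ∫ s in V, ‖u s‖ ∂μ = m := by
    rw [setIntegral_congr_ae (g := fun _ => (1 : ℝ)) hV.measurableSet]
    · simp [hmdef, Measure.real]
    · filter_upwards [hone] with s hs hsV
      rw [hs, Set.indicator_of_mem hsV, norm_one]
  have hint : ∫ s in V, u s ∂μ = m := by
    rw [setIntegral_congr_ae (g := fun _ => (1 : ℂ)) hV.measurableSet]
    · simp [hmdef, Measure.real]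
    · filter_upwards [hone] with s hs hsV
      rw [hs, Set.indicator_of_mem hsV]
  refine ⟨(m : ℂ)⁻¹ * ∫ s in x₀ • V, T u s ∂μ, ?_, fun g ε hε => ?_⟩
  · rw [norm_mul, norm_inv, Complex.norm_real, Real.norm_of_nonneg hm.le, inv_mul_le_iff₀ hm,
      mul_one]
    exact (norm_integral_le_integral_norm _).trans hbound
  · have hε0 : 0 ≤ ε := (norm_nonneg _).trans (hε 1 (mem_of_mem_nhds hV1))
    have h1 := norm_setIntegral_smul_leftRegular_sub_le hp u (ccLp p μ g) (ccLp p μ g) hV hε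
    rw [hnorm, hint] at h1
    have h2 := norm_setIntegral_smul_leftRegular_sub_le hp (T u) (ccLp p μ g)
      (leftRegular p μ x₀ (ccLp p μ g)) hK (ε := ε) (by
        rintro _ ⟨s, hs, rfl⟩
        simp only [smul_eq_mul]
        rw [leftRegular_mul_apply, ← map_sub, norm_leftRegular_apply]
        exact hε s hs)
    have h3 := map_setIntegral_smul_leftRegular hp1 hp g T hT u hV hK (by
      filter_upwards [hone] with s hs hsV
      rw [hs, Set.indicator_of_notMem hsV])
      (ae_map_oneLp_eq_zero hp1 hp hp2 hTn hT hx₀ hV)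
    rw [← h3] at h2
    rw [← hTn, map_sub, map_smul] at h1
    set F := T (∫ s in V, u s • leftRegular p μ s (ccLp p μ g) ∂μ)
    -- `F = T (1_V * g)` is within `ε * m` of each of the two vectors subtracted from it.
    have h4 : (m : ℂ) • (T (ccLp p μ g) - ((m : ℂ)⁻¹ * ∫ s in x₀ • V, T u s ∂μ) •
        leftRegular p μ x₀ (ccLp p μ g))
        = (F - (∫ s in x₀ • V, T u s ∂μ) • leftRegular p μ x₀ (ccLp p μ g))
          - (F - (m : ℂ) • T (ccLp p μ g)) := by
      have hmc : (m : ℂ) ≠ 0 := by exact_mod_cast hm.ne'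
      rw [smul_sub, smul_smul, mul_inv_cancel_left₀ hmc]
      abel
    have h5 := norm_sub_le (F - (∫ s in x₀ • V, T u s ∂μ) • leftRegular p μ x₀ (ccLp p μ g))
      (F - (m : ℂ) • T (ccLp p μ g))
    rw [← h4, norm_smul, Complex.norm_real, Real.norm_of_nonneg hm.le] at h5
    refine le_of_mul_le_mul_left ?_ hm
    have h6 : ε * ∫ s in x₀ • V, ‖T u s‖ ∂μ ≤ ε * m := by gcongr
    linarith

/-- For `p ≠ 2`, the isometries of `L^p(G)` that commute with right translations are the unimodular
multiples of the left translations. -/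
theorem exists_eq_smul_leftRegular (hp1 : 1 < p) (hp : p ≠ ∞) (hp2 : p ≠ 2)
    (hTn : ∀ ξ, ‖T ξ‖ = ‖ξ‖) (hT : ∀ s ξ, T (rightRegular p μ s ξ) = rightRegular p μ s (T ξ)) :
    ∃ (γ : Circle) (s : G), T = (γ : ℂ) • leftRegular p μ s := by
  obtain ⟨x₀, hx₀⟩ := exists_forall_mem_essSupport_map hp1 hp hp2 hTn hT
  -- One scalar must serve all `g` and all `ε`. Each condition is closed in `c`, a single small `V`
  -- handles finitely many of them, and the closed unit disc is compact.
  have key : (Metric.closedBall (0 : ℂ) 1 ∩ ⋂ i : C_c(G, ℂ) × {ε : ℝ // 0 < ε},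
      {c | ‖T (ccLp p μ i.1) - c • leftRegular p μ x₀ (ccLp p μ i.1)‖ ≤ 2 * i.2.1}).Nonempty := by
    refine (isCompact_closedBall (0 : ℂ) 1).inter_iInter_nonempty _ (fun i => ?_) (fun I => ?_)
    · exact isClosed_le (by fun_prop) continuous_const
    · have hN : (⋂ i ∈ I, {s : G | ‖leftRegular p μ s (ccLp p μ i.1) - ccLp p μ i.1‖ ≤ i.2.1})
          ∈ 𝓝 (1 : G) := by
        rw [Filter.biInter_finset_mem]
        intro i _
        have hc : Continuous fun s : G => ‖leftRegular p μ s (ccLp p μ i.1) - ccLp p μ i.1‖ :=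
          ((continuous_leftRegular p μ hp _).sub continuous_const).norm
        have h1 := (hc.tendsto 1).eventually_lt_const (u := i.2.1)
          (by simpa [leftRegular_one_apply] using i.2.2)
        filter_upwards [h1] with s hs using hs.le
      obtain ⟨V, hV1, hVN, hV⟩ := local_compact_nhds hN
      obtain ⟨c, hc, h⟩ := exists_norm_map_ccLp_sub_le hp1 hp hp2 hTn hT hx₀ hV hV1
      refine ⟨c, by simpa using hc, Set.mem_iInter₂.2 fun i hi => h i.1 i.2.1 fun s hs => ?_⟩
      exact Set.mem_iInter₂.1 (hVN hs) i hi
  obtain ⟨c, -, hc⟩ := key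
  have h1 : ∀ g : C_c(G, ℂ), T (ccLp p μ g) = (c • leftRegular p μ x₀) (ccLp p μ g) := by
    intro g
    rw [← sub_eq_zero, ← norm_eq_zero]
    refine le_antisymm (le_of_forall_pos_le_add fun ε hε => ?_) (norm_nonneg _)
    have := Set.mem_iInter.1 hc (g, ⟨ε / 2, by positivity⟩)
    simp only [Set.mem_ofPred_eq] at this
    rw [zero_add]
    calc _ ≤ _ := this
      _ = ε := by ring
  have h2 : T = c • leftRegular p μ x₀ := by
    refine ContinuousLinearMap.ext fun ξ => ?_
    exact congrFun ((denseRange_ccLp p μ hp).equalizer T.continuous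
      (c • leftRegular p μ x₀).continuous (funext h1)) ξ
  have h3 : ‖c‖ = 1 := by
    obtain ⟨ξ, hξ⟩ := exists_ne (0 : Lp ℂ p μ)
    have h4 := hTn ξ
    rw [h2, smul_apply, norm_smul, norm_leftRegular_apply] at h4
    exact mul_right_cancel₀ (norm_ne_zero_iff.2 hξ) (h4.trans (one_mul _).symm)
  exact ⟨⟨c, mem_sphere_zero_iff_norm.2 h3⟩, x₀, h2⟩

end Rigidity

/-! ### The group of invertible isometric convolvers -/

section UnitaryGroup

variable {G : Type*} [Group G] [TopologicalSpace G] [IsTopologicalGroup G]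
  [LocallyCompactSpace G] [MeasurableSpace G] [BorelSpace G]
  {p : ℝ≥0∞} [Fact (1 ≤ p)] {μ : Measure G} [IsLeftHaar μ]

namespace UnitaryCV

theorem toOperator_injective :
    Function.Injective (toOperator : UnitaryCV p μ → Lp ℂ p μ →L[ℂ] Lp ℂ p μ) := by
  intro u v h
  exact Subtype.ext (Units.ext (Subtype.ext h))

theorem toOperator_mul (u v : UnitaryCV p μ) :
    (u * v).toOperator = u.toOperator * v.toOperator := rfl

theorem toOperator_one : (1 : UnitaryCV p μ).toOperator = 1 := rfl

theorem toOperator_rightRegular (u : UnitaryCV p μ) (s : G) (ξ : Lp ℂ p μ) :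
    u.toOperator (rightRegular p μ s ξ) = rightRegular p μ s (u.toOperator ξ) := by
  have h := Subalgebra.mem_centralizer_iff ℂ |>.1
    (((show invertibleIsometries (CV p μ) from u : (CV p μ)ˣ) : CV p μ)).2
    (rightRegular p μ s) ⟨s, rfl⟩
  exact (DFunLike.congr_fun h ξ).symm

theorem norm_toOperator (u : UnitaryCV p μ) : ‖u.toOperator‖ = 1 :=
  (show invertibleIsometries (CV p μ) from u).2.1

theorem norm_toOperator_apply (u : UnitaryCV p μ) (ξ : Lp ℂ p μ) : ‖u.toOperator ξ‖ = ‖ξ‖ := by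
  refine le_antisymm ?_ ?_
  · simpa [norm_toOperator] using u.toOperator.le_opNorm ξ
  · have h : (u⁻¹).toOperator (u.toOperator ξ) = ξ := by
      have : (u⁻¹ * u).toOperator ξ = ξ := by rw [inv_mul_cancel, toOperator_one]; rfl
      rwa [toOperator_mul] at this
    calc ‖ξ‖ = ‖(u⁻¹).toOperator (u.toOperator ξ)‖ := by rw [h]
      _ ≤ _ := by simpa [norm_toOperator] using (u⁻¹).toOperator.le_opNorm (u.toOperator ξ)

theorem continuous_pairing (ω : NuclearSeries (Lp ℂ p μ)) :
    Continuous fun u : UnitaryCV p μ => ω.pairing u.toOperator := by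
  rw [continuous_iff_le_induced]
  refine (induced_mono (iInf_le _ ω)).trans ?_
  rw [induced_compose]
  exact le_rfl

theorem continuous_of_pairing {X : Type*} [TopologicalSpace X] {f : X → UnitaryCV p μ}
    (h : ∀ ω : NuclearSeries (Lp ℂ p μ), Continuous fun x => ω.pairing (f x).toOperator) :
    Continuous f := by
  let _ := weakStarTopology (Lp ℂ p μ)
  refine continuous_induced_rng.2 (continuous_iInf_rng.2 fun ω => continuous_induced_rng.2 ?_)
  exact h ω

/-- An elementary tensor is a nuclear series with a single nonzero term, so the weak-star topology
refines the weak operator topology. -/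
theorem continuous_functional_apply (φ : StrongDual ℂ (Lp ℂ p μ)) (ξ : Lp ℂ p μ) :
    Continuous fun u : UnitaryCV p μ => φ (u.toOperator ξ) := by
  let ω : NuclearSeries (Lp ℂ p μ) :=
    { vec := fun n => if n = 0 then ξ else 0
      fnl := fun _ => φ
      summable_norm := summable_of_ne_finset_zero (s := {0}) fun n hn => by
        rw [Finset.mem_singleton] at hn
        simp [hn] }
  have h : ∀ u : UnitaryCV p μ, ω.pairing u.toOperator = φ (u.toOperator ξ) := fun u => by
    rw [NuclearSeries.pairing, tsum_eq_single 0 fun n hn => by simp [ω, hn]]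
    simp [ω]
  simpa only [h] using continuous_pairing ω

end UnitaryCV

variable (p μ) in
/-- The unimodular multiple `γ λ_p(s)` of a left translation, as a convolver. -/
noncomputable def circleTranslationCV (x : Circle × G) : CV p μ :=
  ⟨(x.1 : ℂ) • leftRegular p μ x.2, by
    rw [Subalgebra.mem_centralizer_iff]
    rintro _ ⟨t, rfl⟩
    refine ContinuousLinearMap.ext fun ξ => ?_
    change rightRegular p μ t ((x.1 : ℂ) • leftRegular p μ x.2 ξ)
      = (x.1 : ℂ) • leftRegular p μ x.2 (rightRegular p μ t ξ)
    rw [map_smul, leftRegular_rightRegular]⟩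

theorem circleTranslationCV_mul (x y : Circle × G) :
    circleTranslationCV p μ (x * y) = circleTranslationCV p μ x * circleTranslationCV p μ y := by
  refine Subtype.ext (ContinuousLinearMap.ext fun ξ => ?_)
  change ((x.1 * y.1 : Circle) : ℂ) • leftRegular p μ (x.2 * y.2) ξ
    = (x.1 : ℂ) • leftRegular p μ x.2 ((y.1 : ℂ) • leftRegular p μ y.2 ξ)
  rw [map_smul, leftRegular_mul_apply, smul_smul, Circle.coe_mul]

theorem circleTranslationCV_one : circleTranslationCV p μ (1 : Circle × G) = 1 := by
  refine Subtype.ext (ContinuousLinearMap.ext fun ξ => ?_)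
  change ((1 : Circle) : ℂ) • leftRegular p μ 1 ξ = ξ
  rw [leftRegular_one_apply, Circle.coe_one, one_smul]

theorem norm_circle_smul_leftRegular_apply (γ : Circle) (s : G) (ξ : Lp ℂ p μ) :
    ‖((γ : ℂ) • leftRegular p μ s) ξ‖ = ‖ξ‖ := by
  rw [smul_apply, norm_smul, Circle.norm_coe, one_mul, norm_leftRegular_apply]

theorem norm_circleTranslationCV (x : Circle × G) : ‖circleTranslationCV p μ x‖ = 1 := by
  change ‖(x.1 : ℂ) • leftRegular p μ x.2‖ = 1
  have h := norm_circle_smul_leftRegular_apply (p := p) (μ := μ) x.1 x.2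
  refine le_antisymm (ContinuousLinearMap.opNorm_le_bound _ zero_le_one fun ξ => ?_) ?_
  · rw [h, one_mul]
  · obtain ⟨ξ, hξ⟩ := exists_ne (0 : Lp ℂ p μ)
    have h1 := ((x.1 : ℂ) • leftRegular p μ x.2).le_opNorm ξ
    rw [h] at h1
    exact le_of_mul_le_mul_right (by rwa [one_mul]) (norm_pos_iff.2 hξ)

variable (p μ) in
/-- The homomorphism `Δ(γ, s) = γ λ_p(s)` into the invertible isometries of `CV_p(G)`. -/
noncomputable def circleTranslation : Circle × G →* UnitaryCV p μ where
  toFun x := (⟨⟨circleTranslationCV p μ x, circleTranslationCV p μ x⁻¹, by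
      rw [← circleTranslationCV_mul, mul_inv_cancel, circleTranslationCV_one], by
      rw [← circleTranslationCV_mul, inv_mul_cancel, circleTranslationCV_one]⟩,
    norm_circleTranslationCV x, norm_circleTranslationCV x⁻¹⟩ : invertibleIsometries (CV p μ))
  map_one' := Subtype.ext (Units.ext circleTranslationCV_one)
  map_mul' x y := Subtype.ext (Units.ext (circleTranslationCV_mul x y))

/-- Each term of a pairing is continuous by strong continuity of `λ_p`. As all the operators are
isometries, the terms are dominated by the summable `‖vec n‖ * ‖fnl n‖`. -/
theorem continuous_circleTranslation (hp : p ≠ ∞) : Continuous (circleTranslation p μ) := by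
  refine UnitaryCV.continuous_of_pairing fun ω => ?_
  refine continuous_tsum (u := fun n => ‖ω.vec n‖ * ‖ω.fnl n‖) (fun n => ?_) ω.summable_norm
    fun n x => ?_
  · have h := continuous_leftRegular p μ hp (ω.vec n)
    have hc : Continuous fun γ : Circle => (γ : ℂ) := continuous_subtype_val
    exact (ω.fnl n).continuous.comp ((hc.comp continuous_fst).smul (h.comp continuous_snd))
  · rw [mul_comm]
    refine ((ω.fnl n).le_opNorm _).trans_eq ?_
    rw [UnitaryCV.norm_toOperator_apply]

/-! ### Bijectivity of `Δ`, continuity of its inverse, and norm components -/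

variable [T2Space G]

theorem coeFn_leftRegular_oneLp (s : G) {V : Set G} (hV : MeasurableSet V) (hμV : μ V ≠ ∞) :
    ∀ᵐ t ∂μ, leftRegular p μ s (oneLp p hV hμV) t = V.indicator (fun _ => 1) (s⁻¹ * t) := by
  filter_upwards [coeFn_leftRegular p μ s (oneLp p hV hμV),
    (measurePreserving_mul_left μ s⁻¹).quasiMeasurePreserving.ae
      (coeFn_oneLp (p := p) hV hμV)] with t h1 h2
  rw [h1, h2]

/-- Multiples of different left translations are at distance more than one. -/
theorem one_lt_norm_circle_smul_leftRegular_sub (hp : p ≠ ∞) (hp2 : p ≠ 2) {s s' : G}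
    (hs : s ≠ s') (γ γ' : Circle) :
    1 < ‖(γ : ℂ) • leftRegular p μ s - (γ' : ℂ) • leftRegular p μ s'‖ := by
  have h0 : p ≠ 0 := (zero_lt_one.trans_le (Fact.out : 1 ≤ p)).ne'
  have hr : 0 < p.toReal := ENNReal.toReal_pos h0 hp
  obtain ⟨U, U', hU, hU', hd⟩ := t2_separation_nhds hs
  have hN : (s * ·) ⁻¹' U ∩ (s' * ·) ⁻¹' U' ∈ 𝓝 (1 : G) := Filter.inter_mem
    ((continuous_const_mul s).continuousAt.preimage_mem_nhds (by simpa using hU))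
    ((continuous_const_mul s').continuousAt.preimage_mem_nhds (by simpa using hU'))
  obtain ⟨V, hV1, hVN, hV⟩ := local_compact_nhds hN
  set ξ : Lp ℂ p μ := oneLp p hV.measurableSet hV.measure_lt_top.ne
  have hξ : ξ ≠ 0 := oneLp_ne_zero hp _ _ (Measure.measure_pos_of_mem_nhds μ hV1).ne'
  set A := (γ : ℂ) • leftRegular p μ s
  set B := (γ' : ℂ) • leftRegular p μ s'
  have hdis : ∀ᵐ t ∂μ, A ξ t = 0 ∨ B ξ t = 0 := by
    filter_upwards [coeFn_leftRegular_oneLp (p := p) s hV.measurableSet hV.measure_lt_top.ne,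
      coeFn_leftRegular_oneLp (p := p) s' hV.measurableSet hV.measure_lt_top.ne,
      Lp.coeFn_smul (γ : ℂ) (leftRegular p μ s ξ),
      Lp.coeFn_smul (γ' : ℂ) (leftRegular p μ s' ξ)] with t h1 h2 h3 h4
    simp only [A, B, smul_apply]
    rw [h3, h4, Pi.smul_apply, Pi.smul_apply, h1, h2]
    by_cases ht : s⁻¹ * t ∈ V
    · right
      rw [Set.indicator_of_notMem, smul_zero]
      intro ht'
      have h5 := (hVN ht).1
      have h6 := (hVN ht').2
      simp only [Set.mem_preimage, mul_inv_cancel_left] at h5 h6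
      exact Set.disjoint_left.1 hd h5 h6
    · left
      rw [Set.indicator_of_notMem ht, smul_zero]
  have hnorm : ‖A ξ + B ξ‖ = ‖A ξ - B ξ‖ := by
    have h : ∀ᵐ t ∂μ, ‖(A ξ + B ξ : Lp ℂ p μ) t‖ = ‖(A ξ - B ξ : Lp ℂ p μ) t‖ := by
      filter_upwards [hdis, Lp.coeFn_add (A ξ) (B ξ), Lp.coeFn_sub (A ξ) (B ξ)] with t h1 h2 h3
      rw [h2, h3, Pi.add_apply, Pi.sub_apply]
      rcases h1 with h1 | h1 <;> simp [h1]
    exact le_antisymm (Lp.norm_le_norm_of_ae_le (h.mono fun t ht => ht.le))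
      (Lp.norm_le_norm_of_ae_le (h.mono fun t ht => ht.ge))
  -- Disjointness gives zero defect, and `hnorm` merges the two mixed terms: `‖A ξ - B ξ‖ ^ p = 2
  -- ‖ξ‖ ^ p`.
  have h1 := (ae_disjoint_iff_clarksonDefect hp hp2 (A ξ) (B ξ)).1 hdis
  rw [clarksonDefect, hnorm, norm_circle_smul_leftRegular_apply,
    norm_circle_smul_leftRegular_apply] at h1
  have hpos : 0 < ‖ξ‖ := norm_pos_iff.2 hξ
  have h2 : ‖ξ‖ ^ p.toReal < ‖A ξ - B ξ‖ ^ p.toReal := by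
    have := Real.rpow_pos_of_pos hpos p.toReal
    linarith
  have h3 := (Real.rpow_lt_rpow_iff hpos.le (norm_nonneg _) hr).1 h2
  have h4 := (A - B).le_opNorm ξ
  rw [sub_apply] at h4
  exact lt_of_mul_lt_mul_right (by rw [one_mul]; exact h3.trans_le h4) hpos.le

theorem circleTranslation_injective (hp : p ≠ ∞) (hp2 : p ≠ 2) :
    Function.Injective (circleTranslation p μ) := by
  rintro ⟨γ, s⟩ ⟨γ', s'⟩ h
  have h1 : (γ : ℂ) • leftRegular p μ s = (γ' : ℂ) • leftRegular p μ s' :=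
    congrArg UnitaryCV.toOperator h
  have hs : s = s' := by
    by_contra hne
    have := one_lt_norm_circle_smul_leftRegular_sub (p := p) (μ := μ) hp hp2 hne γ γ'
    rw [h1, sub_self, norm_zero] at this
    linarith
  subst hs
  obtain ⟨ξ, hξ⟩ := exists_ne (0 : Lp ℂ p μ)
  have h2 := DFunLike.congr_fun h1 ξ
  rw [smul_apply, smul_apply] at h2
  have h3 : leftRegular p μ s ξ ≠ 0 := by
    rw [← norm_ne_zero_iff, norm_leftRegular_apply, norm_ne_zero_iff]; exact hξ
  rw [Circle.ext (smul_left_injective ℂ h3 h2)]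

theorem circleTranslation_surjective (hp1 : 1 < p) (hp : p ≠ ∞) (hp2 : p ≠ 2) :
    Function.Surjective (circleTranslation p μ) := by
  intro u
  obtain ⟨γ, s, h⟩ := exists_eq_smul_leftRegular hp1 hp hp2 u.norm_toOperator_apply
    u.toOperator_rightRegular
  exact ⟨(γ, s), UnitaryCV.toOperator_injective h.symm⟩

variable (p μ) in
/-- The group isomorphism `Δ(γ, s) = γ λ_p(s)` onto the invertible isometries of `CV_p(G)`. -/
noncomputable def circleTranslationEquiv (hp1 : 1 < p) (hp : p ≠ ∞) (hp2 : p ≠ 2) :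
    Circle × G ≃* UnitaryCV p μ :=
  MulEquiv.ofBijective (circleTranslation p μ)
    ⟨circleTranslation_injective hp hp2, circleTranslation_surjective hp1 hp hp2⟩

/-- Pairing `γ λ_p(s) 1_V` with the indicator of `s₀ • V` gives a weak-star continuous function `Φ =
γ F(s)`, with `F` nonzero at `s₀` and supported in `s₀ • (V * V⁻¹)`. Nonvanishing of `Φ` near `u₀`
confines `s`, whatever `γ` is; once `s` is known to converge, `γ = Φ / F(s)` converges too. -/
theorem continuous_circleTranslationEquiv_symm (hp1 : 1 < p) (hp : p ≠ ∞) (hp2 : p ≠ 2) :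
    Continuous (circleTranslationEquiv p μ hp1 hp hp2).symm := by
  set E := circleTranslationEquiv p μ hp1 hp hp2
  let r := ENNReal.conjExponent p
  have : Fact (1 ≤ r) := ⟨by simp [r, ENNReal.conjExponent]⟩
  rw [continuous_iff_continuousAt]
  intro u₀
  set γ₀ := (E.symm u₀).1
  set s₀ := (E.symm u₀).2
  have happ : ∀ (u : UnitaryCV p μ) (ξ : Lp ℂ p μ),
      u.toOperator ξ = ((E.symm u).1 : ℂ) • leftRegular p μ (E.symm u).2 ξ := fun u ξ => by
    conv_lhs => rw [← E.apply_symm_apply u]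
    rfl
  have key : ∀ V : Set G, IsCompact V → V ∈ 𝓝 (1 : G) →
      ∃ (F : G → ℂ) (Φ : UnitaryCV p μ → ℂ), Continuous F ∧ Continuous Φ ∧ F s₀ ≠ 0 ∧
        (∀ s, F s ≠ 0 → s ∈ s₀ • (V * V⁻¹)) ∧
        ∀ u, Φ u = ((E.symm u).1 : ℂ) * F (E.symm u).2 := by
    intro V hV hV1
    have hsV : IsCompact (s₀ • V) := hV.smul s₀
    let φ : StrongDual ℂ (Lp ℂ p μ) :=
      lpFunctional (oneLp r hsV.measurableSet hsV.measure_lt_top.ne)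
    let ξ : Lp ℂ p μ := oneLp p hV.measurableSet hV.measure_lt_top.ne
    have hF : ∀ s, φ (leftRegular p μ s ξ)
        = ∫ t in s₀ • V, V.indicator (fun _ => (1 : ℂ)) (s⁻¹ * t) ∂μ := fun s => by
      rw [lpFunctional_indicatorConstLp]
      refine setIntegral_congr_ae hsV.measurableSet ?_
      filter_upwards [coeFn_leftRegular_oneLp (p := p) s hV.measurableSet hV.measure_lt_top.ne]
        with t ht _ using ht
    refine ⟨fun s => φ (leftRegular p μ s ξ), fun u => φ (u.toOperator ξ),
      φ.continuous.comp (continuous_leftRegular p μ hp ξ),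
      UnitaryCV.continuous_functional_apply φ ξ, ?_, fun s hs => ?_, fun u => ?_⟩
    · simp only
      rw [hF, setIntegral_congr_fun (g := fun _ => (1 : ℂ)) hsV.measurableSet]
      · simp only [integral_const, Complex.real_smul, mul_one, ne_eq,
          Complex.ofReal_eq_zero, Measure.real, Measure.restrict_apply_univ, measure_smul]
        exact (ENNReal.toReal_pos (Measure.measure_pos_of_mem_nhds μ hV1).ne'
          hV.measure_lt_top.ne).ne'
      · rintro _ ⟨t, ht, rfl⟩
        simp [ht]
    · by_contra hne
      refine hs ?_
      simp only
      rw [hF, setIntegral_congr_fun (g := fun _ => (0 : ℂ)) hsV.measurableSet, integral_zero]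
      rintro _ ⟨t, ht, rfl⟩
      refine Set.indicator_of_notMem (fun ht' => hne ?_) _
      refine ⟨t * (s⁻¹ * (s₀ • t))⁻¹, ⟨t, ht, _, Set.inv_mem_inv.2 ht', rfl⟩, ?_⟩
      simp [mul_assoc]
    · simp only [happ, map_smul, smul_eq_mul]
  have h2 : Filter.Tendsto (fun u => (E.symm u).2) (𝓝 u₀) (𝓝 s₀) := by
    intro N hN
    have hc : Continuous fun x : G × G => s₀ * (x.1 * x.2⁻¹) := by fun_prop
    have hmem : {x : G × G | s₀ * (x.1 * x.2⁻¹) ∈ N} ∈ 𝓝 ((1, 1) : G × G) :=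
      hc.continuousAt.preimage_mem_nhds (by simpa using hN)
    rw [nhds_prod_eq, Filter.mem_prod_self_iff] at hmem
    obtain ⟨U, hU, hUN⟩ := hmem
    obtain ⟨V, hV1, hVU, hV⟩ := local_compact_nhds hU
    obtain ⟨F, Φ, -, hΦ, hF0, hFs, hΦF⟩ := key V hV hV1
    have h0 : Φ u₀ ≠ 0 := by
      rw [hΦF]; exact mul_ne_zero (Circle.coe_ne_zero _) hF0
    rw [Filter.mem_map]
    filter_upwards [hΦ.continuousAt.eventually_ne h0] with u hu
    rw [hΦF] at hu
    obtain ⟨_, ⟨a, ha, b, hb, rfl⟩, hab⟩ := hFs _ (right_ne_zero_of_mul hu)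
    have := hUN (show (a, b⁻¹) ∈ U ×ˢ U from ⟨hVU ha, hVU hb⟩)
    simp only [Set.mem_ofPred_eq, inv_inv] at this
    rw [Set.mem_preimage, ← hab]
    exact this
  have h1 : Filter.Tendsto (fun u => (E.symm u).1) (𝓝 u₀) (𝓝 γ₀) := by
    obtain ⟨V, hV, hV1⟩ := exists_compact_mem_nhds (1 : G)
    obtain ⟨F, Φ, hF, hΦ, hF0, -, hΦF⟩ := key V hV hV1
    have hFt : Filter.Tendsto (fun u => F (E.symm u).2) (𝓝 u₀) (𝓝 (F s₀)) :=
      (hF.tendsto s₀).comp h2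
    have h3 := (hΦ.tendsto u₀).div hFt hF0
    rw [hΦF u₀, mul_div_cancel_right₀ _ hF0] at h3
    have hind : IsInducing (fun γ : Circle => (γ : ℂ)) := IsInducing.subtypeVal
    rw [hind.tendsto_nhds_iff]
    refine h3.congr' ?_
    filter_upwards [hFt.eventually_ne hF0] with u hu
    simp only [Pi.div_apply, Function.comp_apply]
    rw [hΦF u, mul_div_cancel_right₀ _ hu]
  exact h1.prodMk_nhds h2

/-- The norm-connected component of the unit consists of the unimodular scalars. -/
theorem mem_unitComponent_iff (hp1 : 1 < p) (hp : p ≠ ∞) (hp2 : p ≠ 2) (x : Circle × G) :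
    circleTranslation p μ x ∈ UnitaryCV.unitComponent p μ ↔ x.2 = 1 := by
  set E := circleTranslationEquiv p μ hp1 hp hp2
  have hind := isInducing_coe_invertibleIsometries (CV p μ)
  constructor
  · intro hx
    let σ : invertibleIsometries (CV p μ) → G := fun u => (E.symm u).2
    -- Operators at norm distance less than `1` have the same translation part, so the fibres of `σ`
    -- are clopen and the component of the unit stays in the fibre over `1`.
    have hσ : IsLocallyConstant σ := by
      rw [IsLocallyConstant.iff_eventually_eq]
      intro u
      have hball : ∀ᶠ v : invertibleIsometries (CV p μ) in 𝓝 u,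
          dist ((v : (CV p μ)ˣ) : CV p μ) ((u : (CV p μ)ˣ) : CV p μ) < 1 :=
        hind.continuous.continuousAt.eventually (Metric.ball_mem_nhds _ one_pos)
      filter_upwards [hball] with v hv
      by_contra hne
      have h1 := one_lt_norm_circle_smul_leftRegular_sub (p := p) (μ := μ) hp hp2 hne
        (E.symm v).1 (E.symm u).1
      refine (h1.trans ?_).false
      rw [dist_eq_norm] at hv
      have hv' : ‖UnitaryCV.toOperator v - UnitaryCV.toOperator u‖ < 1 := hv
      rw [← E.apply_symm_apply v, ← E.apply_symm_apply u] at hv'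
      exact hv'
    have h1 : σ 1 = 1 := by
      have : E.symm 1 = 1 := map_one _
      exact congrArg Prod.snd this
    have h2 := (hσ.isClopen_fiber 1).connectedComponent_subset (x := 1) h1 hx
    have h3 : E.symm (circleTranslation p μ x) = x := E.symm_apply_apply x
    exact (congrArg Prod.snd h3).symm.trans h2
  · intro hx
    -- Conversely, the scalars form a norm-continuous image of the connected circle.
    let c : Circle → invertibleIsometries (CV p μ) := fun γ => circleTranslation p μ (γ, 1)
    have hc : Continuous c := by
      rw [hind.continuous_iff]
      refine continuous_induced_rng.2 ?_
      have hco : Continuous fun γ : Circle => (γ : ℂ) := continuous_subtype_val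
      exact hco.smul (continuous_const (y := leftRegular p μ (1 : G)))
    have h1 : c 1 = 1 := map_one (circleTranslation p μ)
    have h2 := (isPreconnected_range hc).subset_connectedComponent (x := 1) ⟨1, h1⟩
    obtain ⟨γ, s⟩ := x
    subst hx
    exact h2 ⟨γ, rfl⟩

variable (p μ) in
/-- The homomorphism `Δ'(s) = [λ_p(s)]` into the group of norm-connected components. -/
noncomputable def translationPi0 : G →* Pi0UnitaryCV p μ :=
  (QuotientGroup.mk' (UnitaryCV.unitComponent p μ)).comp
    ((circleTranslation p μ).comp (MonoidHom.inr Circle G))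

/-- The scalar factor is invisible in the quotient: `(1, x.2)⁻¹ * x` has trivial second coordinate.
-/
theorem translationPi0_snd (hp1 : 1 < p) (hp : p ≠ ∞) (hp2 : p ≠ 2) (x : Circle × G) :
    translationPi0 p μ x.2 = QuotientGroup.mk (circleTranslation p μ x) := by
  refine QuotientGroup.eq.2 ?_
  change (circleTranslation p μ (1, x.2))⁻¹ * circleTranslation p μ x ∈ _
  rw [← map_inv, ← map_mul, mem_unitComponent_iff hp1 hp hp2]
  simp

theorem translationPi0_bijective (hp1 : 1 < p) (hp : p ≠ ∞) (hp2 : p ≠ 2) :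
    Function.Bijective (translationPi0 p μ) := by
  constructor
  · rw [injective_iff_map_eq_one]
    intro s hs
    exact (mem_unitComponent_iff hp1 hp hp2 ((1, s) : Circle × G)).1
      ((QuotientGroup.eq_one_iff _).1 hs)
  · intro u
    obtain ⟨u, rfl⟩ := QuotientGroup.mk_surjective u
    obtain ⟨x, rfl⟩ := circleTranslation_surjective hp1 hp hp2 u
    exact ⟨x.2, translationPi0_snd hp1 hp hp2 x⟩

end UnitaryGroup

end Convolvers

open Convolvers
theorem mainTheorem5 {G : Type*} [Group G] [TopologicalSpace G] [IsTopologicalGroup G]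
    [LocallyCompactSpace G] [T2Space G] [MeasurableSpace G] [BorelSpace G]
    (μ : Measure G) [IsLeftHaar μ]
    (p : ℝ≥0∞) [Fact (1 ≤ p)] (hp1 : 1 < p) (hp_top : p ≠ ∞) (hp2 : p ≠ 2) :
    ∃ (Δ : Circle × G ≃ₜ* UnitaryCV p μ) (Δ' : G ≃ₜ* Pi0UnitaryCV p μ),
      (∀ (γ : Circle) (s : G), (Δ (γ, s)).toOperator = (γ : ℂ) • leftRegular p μ s) ∧
      ∀ s : G, Δ' s = QuotientGroup.mk (Δ (1, s)) := by
  let E := circleTranslationEquiv p μ hp1 hp_top hp2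
  have hE : Continuous E := continuous_circleTranslation hp_top
  have hE' : Continuous E.symm := continuous_circleTranslationEquiv_symm hp1 hp_top hp2
  let Q := MulEquiv.ofBijective (translationPi0 p μ) (translationPi0_bijective hp1 hp_top hp2)
  have hQ : Continuous Q := by
    have h : Continuous fun s : G => E ((1 : Circle), s) := hE.comp (by fun_prop)
    exact continuous_quotient_mk'.comp h
  have hQ' : Continuous Q.symm := by
    -- By the universal property of the quotient topology it is enough that `Q.symm` composed with
    -- the projection is continuous; this composite is the second coordinate of `E.symm`.
    refine (QuotientGroup.isQuotientMap_mk (UnitaryCV.unitComponent p μ)).continuous_iff.2 ?_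
    refine (continuous_snd.comp hE').congr fun u => ?_
    rw [Function.comp_apply, Function.comp_apply, MulEquiv.eq_symm_apply]
    refine (translationPi0_snd hp1 hp_top hp2 (E.symm u)).trans ?_
    exact congrArg _ (E.apply_symm_apply u)
  exact ⟨{ E with continuous_toFun := hE, continuous_invFun := hE' },
    { Q with continuous_toFun := hQ, continuous_invFun := hQ' }, fun _ _ => rfl, fun _ => rfl⟩
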